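/- **Setting.** Let $P=(p_{xy})$ be the transition matrix of an ergodic (irreducible and aperiodic) Markov chain on a finite set $X$, let $\pi$ be its stationary distribution, and let $P^*=(p^*_{yx})$, $\pi_x p_{xy}=\pi_y p^*_{yx}$, be the time-reversed chain; $P$ is reversible if $P=P^*$. The eigenvalue gap of $P$ is $1-\max|\lambda|$ over the eigenvalues $\lambda\neq1$ of $P$ (and $1$ if there are none). Let $M\subseteq X$ be the set of marked elements. A data structure attaches data $d(x)$ to each $x\in X$; write $|x\rangle_d=|x,d(x)\rangle$, and fix a blank state $|\bar 0\rangle_d$ with $\bar 0\in X$. A quantum algorithm acts on a left and a right register, each with the orthonormal basis $(|x\rangle_d)_{x\in X}$, and on finitely many ancilla qubits, all initially blank. It has access to $P$, $\pi$, $d$ and $M$ only through the following operations, with their costs: * *Setup*, cost $\mathsf S$: discard the contents of all registers and construct the state $\sum_x\sqrt{\pi_x}\,|x\rangle_d|\bar 0\rangle_d$ with ancillas $|0\cdots0\rangle$. * *Update*, cost $\mathsf U$: apply one of two unitaries, or one of their inverses, that satisfy $|x\rangle_d|\bar 0\rangle_d\mapsto|x\rangle_d\sum_y\sqrt{p_{xy}}\,|y\rangle_d$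 and $|\bar 0\rangle_d|y\rangle_d\mapsto\sum_x\sqrt{p^*_{yx}}\,|x\rangle_d|y\rangle_d$ respectively, and that are arbitrary on other inputs. * *Checking*, cost $\mathsf C$: apply the unitary that maps $|x\rangle_d|y\rangle_d$ to $-|x\rangle_d|y\rangle_d$ if $x\in M$ and leaves it unchanged otherwise; or observe the left register and test whether the element found is marked, stopping with this element as output if it is. Operations that do not depend on $P$, $\pi$, $d$, $M$ are not accounted for: unitaries on the ancilla qubits, measurements of ancilla qubits, and the reflections $2\Pi-\mathrm{Id}$ through the states whose left (or right) register is $|\bar 0\rangle_d$, possibly controlled by the ancilla qubits. The cost of an algorithm is its worst-case cost over all measurement outcomes. An algorithm stops either with an element of $M$ as output or with the output "no marked element exists". **Theorem.** For every $\eta>0$ there is a constant $K$ such that for all $\delta,\varepsilon>0$ there is a quantum algorithm, depending only on $\eta,\delta,\varepsilon$, with cost at most $$K\left(\mathsf S+\frac1{\sqrt\varepsilon}\left(\frac1{\sqrt\delta}\,\mathsf U+\mathsf C\right)\right)\qquad\text{for all }\mathsf S,\mathsf U,\mathsf C\ge0,$$ such that the following holds for every finite $X$, every reversible ergodic Markov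 chain $P$ on $X$ with eigenvalue gap $\delta$ and stationary distribution $\pi$, every data structure $d$, blank element $\bar 0\in X$ and update unitaries as above, and every $M\subseteq X$ with $\sum_{x\in M}\pi_x\ge\varepsilon$ whenever $M\neq\emptyset$: with probability at least $1-\eta$ the algorithm outputs "no marked element exists" if $M=\emptyset$, and outputs an element of $M$ if $M\neq\emptyset$. -/

import Mathlib

open scoped Matrix Kronecker

noncomputable section

namespace QuantumWalkSearch

/-! ## Finite Markov chains

A Markov chain on a finite state space `X` is identified with its transition matrix `P`. -/

section Chain

variable {X : Type*} [Fintype X] [DecidableEq X]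

/-- `p` is a stationary probability distribution of `P`. -/
def IsStationary (P : Matrix X X ℝ) (p : X → ℝ) : Prop :=
  p ∈ stdSimplex ℝ X ∧ p ᵥ* P = p

/-- Every state has period one: `1` is the only common divisor of its return times. -/
def IsAperiodic (P : Matrix X X ℝ) : Prop :=
  ∀ x : X, ∀ n : ℕ, (∀ k : ℕ, 0 < k → 0 < (P ^ k) x x → n ∣ k) → n = 1

/-- An ergodic Markov chain: stochastic, irreducible and aperiodic. -/
structure IsErgodicChain (P : Matrix X X ℝ) : Prop where
  stochastic : P ∈ Matrix.rowStochastic ℝ X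
  irreducible : P.IsIrreducible
  aperiodic : IsAperiodic P

/-- The time-reversed chain `P*`, defined by `π_x p_{xy} = π_y p*_{yx}`
(here `p` is the stationary distribution). -/
def timeReversal (P : Matrix X X ℝ) (p : X → ℝ) : Matrix X X ℝ :=
  Matrix.of fun y x => p x * P x y / p y

/-- The chain is reversible if it equals its time reversal. -/
def IsReversibleChain (P : Matrix X X ℝ) (p : X → ℝ) : Prop :=
  P = timeReversal P p

/-- The eigenvalue gap `1 - max |λ|`, with `λ` ranging over the (complex) eigenvalues of `P`
different from `1`. For a one-point chain there is no such `λ`, and the gap is `1`. -/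
def eigenvalueGap (P : Matrix X X ℝ) : ℝ :=
  1 - sSup {r : ℝ | ∃ l ∈ spectrum ℂ (P.map (Complex.ofReal)), l ≠ 1 ∧ r = ‖l‖}

end Chain

/-! ## States with data -/

/-- The set `X_d` of pairs `(x, d x)`. -/
def DataState {X D : Type*} (d : X → D) : Type _ := {q : X × D // q.2 = d q.1}

section Data

variable {X D : Type*} {d : X → D}

/-- The element of the state space. -/
def DataState.point (q : DataState d) : X := q.1.1

/-- The pair `(x, d x)`. -/
def withData (d : X → D) (x : X) : DataState d := ⟨(x, d x), rfl⟩

/-- `X_d` is in bijection with `X`. -/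
def dataEquiv (d : X → D) : X ≃ DataState d where
  toFun := withData d
  invFun := DataState.point
  left_inv _ := rfl
  right_inv := by
    rintro ⟨⟨x, y⟩, h⟩
    exact Subtype.ext (Prod.ext rfl h.symm)

instance [Fintype X] : Fintype (DataState d) := Fintype.ofEquiv X (dataEquiv d)

instance [DecidableEq X] : DecidableEq (DataState d) := (dataEquiv d).symm.decidableEq

end Data

/-! ## The update operations -/

/-- An implementation of the two update transformations, given as unitary operators on
`ℂ^(X_d × X_d)`. They are prescribed only on the inputs on which one register is blank, the blank
state being `|z, d z⟩` for a distinguished `z : X`; elsewhere they are arbitrary. -/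
structure WalkUpdates {X D : Type*} [Fintype X] [DecidableEq X] (d : X → D) (z : X)
    (P : Matrix X X ℝ) (p : X → ℝ) where
  /-- `|x⟩|z⟩ ↦ |x⟩ ∑ y, √p_{xy} |y⟩` -/
  right : Matrix.unitaryGroup (DataState d × DataState d) ℂ
  /-- `|z⟩|y⟩ ↦ ∑ x, √p*_{yx} |x⟩|y⟩` -/
  left : Matrix.unitaryGroup (DataState d × DataState d) ℂ
  right_blank : ∀ x : X,
    right.1 *ᵥ Pi.single (withData d x, withData d z) 1 =
      fun q : DataState d × DataState d => if q.1 = withData d x then ((√(P x q.2.point) : ℝ) : ℂ) else 0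
  left_blank : ∀ y : X,
    left.1 *ᵥ Pi.single (withData d z, withData d y) 1 =
      fun q : DataState d × DataState d => if q.2 = withData d y then ((√(timeReversal P p y q.1.point) : ℝ) : ℂ) else 0

/-! ## Quantum algorithms

An algorithm is a symbolic program. It refers neither to the chain nor to the marked set, and has
access to them only through the setup, update and checking operations. -/

/-- Contents of `m` ancilla qubits, in the computational basis. -/
abbrev Qubits (m : ℕ) : Type := Fin m → Bool

/-- The unitary instructions. -/
inductive Gate (m : ℕ) : Type
  /-- a unitary operator on the ancilla qubits -/
  | ancilla (G : Matrix.unitaryGroup (Qubits m) ℂ)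
  /-- the reflection `2 Π - Id` through the states whose left register is blank,
  controlled by the ancilla qubits -/
  | reflectLeft (c : Qubits m → Bool)
  /-- the reflection `2 Π - Id` through the states whose right register is blank,
  controlled by the ancilla qubits -/
  | reflectRight (c : Qubits m → Bool)
  | updateRight
  | updateRightInv
  | updateLeft
  | updateLeftInv
  /-- the phase flip of the states whose left register is marked -/
  | check

/-- Quantum programs with `m` ancilla qubits. -/
inductive Program (m : ℕ) : Type
  /-- stop and output `no marked element exists` -/
  | reportEmpty
  /-- discard the contents of all registers, construct the initial state, and continue -/
  | setup (k : Program m)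
  /-- apply a gate, and continue -/
  | gate (g : Gate m) (k : Program m)
  /-- measure an ancilla qubit, and continue according to the outcome (`0`, respectively `1`) -/
  | measure (i : Fin m) (k₀ k₁ : Program m)
  /-- observe the left register and check the element found: if it is marked, then stop and
  output it, otherwise continue -/
  | observe (k : Program m)

/-- The accounted cost of a gate, for update cost `U` and checking cost `C`. -/
def Gate.cost {m : ℕ} (U C : ℝ) : Gate m → ℝ
  | .ancilla _ => 0
  | .reflectLeft _ => 0
  | .reflectRight _ => 0
  | .updateRight => U
  | .updateRightInv => U
  | .updateLeft => U
  | .updateLeftInv => U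
  | .check => C

/-- The worst-case cost of a program, for setup cost `S`, update cost `U`, checking cost `C`. -/
def Program.cost {m : ℕ} (S U C : ℝ) : Program m → ℝ
  | .reportEmpty => 0
  | .setup k => S + k.cost S U C
  | .gate g k => g.cost U C + k.cost S U C
  | .measure _ k₀ k₁ => max (k₀.cost S U C) (k₁.cost S U C)
  | .observe k => C + k.cost S U C

section Semantics

variable {X D : Type*} [Fintype X] [DecidableEq X] {d : X → D} {z : X}
  {P : Matrix X X ℝ} {p : X → ℝ}

/-- Basis states: left and right register (with data), and the ancilla qubits. -/
abbrev Basis (d : X → D) (m : ℕ) : Type _ := (DataState d × DataState d) × Qubits m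

/-- The matrix of a gate on the whole space. -/
def Gate.matrix {m : ℕ} (W : WalkUpdates d z P p) (M : Finset X) :
    Gate m → Matrix (Basis d m) (Basis d m) ℂ
  | .ancilla G => 1 ⊗ₖ G.1
  | .reflectLeft c =>
      Matrix.diagonal fun b => if c b.2 = true ∧ b.1.1 ≠ withData d z then -1 else 1
  | .reflectRight c =>
      Matrix.diagonal fun b => if c b.2 = true ∧ b.1.2 ≠ withData d z then -1 else 1
  | .updateRight => (W.right : Matrix _ _ ℂ) ⊗ₖ (1 : Matrix _ _ ℂ)
  | .updateRightInv => W.right.1ᴴ ⊗ₖ 1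
  | .updateLeft => (W.left : Matrix _ _ ℂ) ⊗ₖ (1 : Matrix _ _ ℂ)
  | .updateLeftInv => W.left.1ᴴ ⊗ₖ 1
  | .check => Matrix.diagonal fun b => if b.1.1.point ∈ M then -1 else 1

/-- The state `|z⟩|z⟩|0…0⟩` with all registers blank. -/
def blankState (d : X → D) (z : X) (m : ℕ) : Basis d m → ℂ :=
  Pi.single ((withData d z, withData d z), fun _ => false) 1

/-- The state `∑ x, √π_x |x⟩|z⟩|0…0⟩` constructed by the setup operation. -/
def setupState (d : X → D) (z : X) (p : X → ℝ) (m : ℕ) : Basis d m → ℂ := fun b =>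
  if b.1.2 = withData d z ∧ b.2 = (fun _ => false) then ((√(p b.1.1.point) : ℝ) : ℂ) else 0

/-- The squared Euclidean norm of a vector. -/
def normSq {ι : Type*} [Fintype ι] (v : ι → ℂ) : ℝ := ∑ i, ‖v i‖ ^ 2

/-- The projection of a state on the basis states that satisfy a condition. -/
def project {ι : Type*} (s : ι → Bool) (v : ι → ℂ) : ι → ℂ := fun i => if s i = true then v i else 0

/-- `k.run W M v o` is the probability that the program `k`, started in the state `v`, stops
with output `o`; here `none` stands for `no marked element exists`. For a vector `v` that is not
normalized (the branch of an earlier measurement), the probability is multiplied by `‖v‖²`. -/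
def Program.run {m : ℕ} (W : WalkUpdates d z P p) (M : Finset X) :
    Program m → (Basis d m → ℂ) → Option X → ℝ
  | .reportEmpty, v, o => if o = none then normSq v else 0
  | .setup k, v, o => normSq v * k.run W M (setupState d z p m) o
  | .gate g k, v, o => k.run W M (g.matrix W M *ᵥ v) o
  | .measure i k₀ k₁, v, o =>
      k₀.run W M (project (fun b => !b.2 i) v) o + k₁.run W M (project (fun b => b.2 i) v) o
  | .observe k, v, o =>
      ∑ x : X, if x ∈ M then
          (if o = some x then normSq (project (fun b => decide (b.1.1.point = x)) v) else 0)
        else k.run W M (project (fun b => decide (b.1.1.point = x)) v) o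

/-- The probability that the program, started with all registers blank, gives a correct answer:
it reports that there is no marked element if `M` is empty, and outputs an element of `M`
otherwise. -/
def Program.successProb {m : ℕ} (k : Program m) (W : WalkUpdates d z P p) (M : Finset X) : ℝ :=
  if M = ∅ then k.run W M (blankState d z m) none
  else ∑ x ∈ M, k.run W M (blankState d z m) (some x)

end Semantics

end QuantumWalkSearch

end

open QuantumWalkSearch

set_option linter.unusedSectionVars false

/-! The stationary state `s = ∑ √π_x |x⟩|0̄⟩` has marked amplitude `√π(M) ≥ √ε`. With an exact
reflection through `s`, amplitude amplification would make this amplitude constant in about `1/√ε`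
steps. The proof builds an approximate reflection from a quantum walk and shows that neither its
errors nor the unknown value of `π(M)` costs a logarithmic factor.

Approximate reflection. The walk `V` (`walkMatrix`) is a product of two reflections. On a
right-blank state given by an eigenvector of the discriminant with eigenvalue `l`, `V + V*` acts as
`2(2l² - 1)` (`walkMatrix_add_mulVec`), so an eigenvalue gap `δ` becomes a phase gap of order `√δ`.
Averaging the powers of `V` below `2^n ≈ 1/√δ` at least halves every right-blank state orthogonal to
`s`. Repeating this `k + 5` times on fresh qubits gives precision `2^-(k+5)`
(`normSq_averageProduct_le`), while `s` itself is fixed exactly.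

Recursion. `A_{k+1} = A_k R_k A_k⁻¹ B A_k`, with `B` the marked phase flip and `R_k` the approximate
reflection, triples the marked amplitude `a_k` up to a relative error `O(a_k² + 2^-k)`
(`norm_amplify`). These errors are summable, so growth like `3^k` continues until `a_k` is of
constant order. The cost obeys `c_{k+1} = 3 c_k + C + O(k) U/√δ`, hence is `O(3^k)` because `∑ k
3^-k` converges.

Unknown mass. The right level depends on `π(M)`, and a fresh setup for each level would be too
expensive. Instead `searchStages` passes one state through all levels: it applies `A_k⁻¹ B A_k` and
tests whether the state is still `s`. After a failed test, `A_k` is applied and the left register is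
observed; otherwise the next level follows. The levels below the good level `i` displace the state
by at most `2 ∑_{j<i} a_j ≤ (4/3) a_i`, while the failed test at level `i` carries marked amplitude
at least `(12/7) a_i`, so a constant probability remains (`sq_le_findProb_searchStages`,
`le_findProb_searchRound`). A constant number of rounds then reaches `1 - η`; when `M` is empty no
error is possible. -/

namespace QuantumWalkSearch

/-! ### Amplitude amplification with an approximate reflection. -/

section Amplification

variable {E : Type*} [NormedAddCommGroup E] [InnerProductSpace ℂ E]

lemma IsSymmetricProjection.apply_apply {T : E →ₗ[ℂ] E} (hT : T.IsSymmetricProjection) (v : E) :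
    T (T v) = T v :=
  congrArg (fun S : E →ₗ[ℂ] E => S v) hT.isIdempotentElem

lemma IsSymmetricProjection.inner_apply_self {T : E →ₗ[ℂ] E} (hT : T.IsSymmetricProjection)
    (v : E) : inner ℂ v (T v) = ((‖T v‖ ^ 2 : ℝ) : ℂ) := by
  rw [← IsSymmetricProjection.apply_apply hT v, ← hT.isSymmetric,
    inner_self_eq_norm_sq_to_K, IsSymmetricProjection.apply_apply hT v]
  norm_cast

lemma IsSymmetricProjection.norm_sq_add {T : E →ₗ[ℂ] E} (hT : T.IsSymmetricProjection)
    (v : E) : ‖T v‖ ^ 2 + ‖v - T v‖ ^ 2 = ‖v‖ ^ 2 := by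
  have h := norm_sub_sq (𝕜 := ℂ) v (T v)
  rw [IsSymmetricProjection.inner_apply_self hT] at h
  simp only [RCLike.re_to_complex, Complex.ofReal_re] at h
  linarith

lemma IsSymmetricProjection.norm_apply_le {T : E →ₗ[ℂ] E} (hT : T.IsSymmetricProjection)
    (v : E) : ‖T v‖ ≤ ‖v‖ := by
  have h := IsSymmetricProjection.norm_sq_add hT v
  exact le_of_sq_le_sq (by nlinarith [sq_nonneg ‖v - T v‖]) (norm_nonneg v)

/-- The data of one step of amplitude amplification: a unit start vector `s`, a preparation `A`,
the reflection `B = 1 - 2 T` through the unmarked states, and a projection `Q` that fixes `s` and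
almost annihilates the vectors of `F` that are orthogonal to `s`. -/
structure AmplificationStep (s : E) (T Q : E →ₗ[ℂ] E) (A B : E ≃ₗᵢ[ℂ] E) (F : Submodule ℂ E)
    (β : ℝ) : Prop where
  norm_start : ‖s‖ = 1
  proj_marked : T.IsSymmetricProjection
  proj_approx : Q.IsSymmetricProjection
  reflect : ∀ v, B v = v - (2 : ℂ) • T v
  fix : Q s = s
  start_mem : s ∈ F
  mem : A.symm (B (A s)) ∈ F
  nonneg : 0 ≤ β
  small : ∀ v ∈ F, inner ℂ s v = 0 → ‖Q v‖ ≤ β * ‖v‖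

namespace AmplificationStep

variable {s : E} {T Q : E →ₗ[ℂ] E} {A B : E ≃ₗᵢ[ℂ] E} {F : Submodule ℂ E} {β : ℝ}

/-- The component orthogonal to the start vector after the marked reflection. -/
lemma exists_orthogonal (h : AmplificationStep s T Q A B F β) :
    ∃ w ∈ F, inner ℂ s w = 0 ∧ ‖w‖ ≤ 2 * ‖T (A s)‖ ∧
      A.symm (B (A s)) = ((1 - 2 * ‖T (A s)‖ ^ 2 : ℝ) : ℂ) • s + w ∧
      A w = ((2 * ‖T (A s)‖ ^ 2 : ℝ) : ℂ) • A s - (2 : ℂ) • T (A s) := by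
  set a : ℝ := ‖T (A s)‖ with ha
  have hss : inner ℂ s s = (1 : ℂ) := by
    rw [inner_self_eq_norm_sq_to_K, h.norm_start]; norm_num
  have hsg : inner ℂ s (A.symm (T (A s))) = ((a ^ 2 : ℝ) : ℂ) := by
    rw [← A.inner_map_map, A.apply_symm_apply,
      IsSymmetricProjection.inner_apply_self h.proj_marked]
  have hw : A.symm (B (A s)) - ((1 - 2 * a ^ 2 : ℝ) : ℂ) • s
      = ((2 * a ^ 2 : ℝ) : ℂ) • s - (2 : ℂ) • A.symm (T (A s)) := by
    rw [h.reflect, map_sub, map_smul, A.symm_apply_apply]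
    push_cast
    module
  -- `1 - 2a²` is the inner product of `s` with `A⁻¹BAs`, so the remainder is orthogonal to `s`. Its
  -- squared norm is exactly `4a² - 4a⁴`.
  refine ⟨A.symm (B (A s)) - ((1 - 2 * a ^ 2 : ℝ) : ℂ) • s, ?_, ?_, ?_, by abel, ?_⟩
  · exact F.sub_mem h.mem (F.smul_mem _ h.start_mem)
  · rw [hw, inner_sub_right, inner_smul_right, inner_smul_right, hss, hsg]
    push_cast; ring
  · rw [hw]
    have h1 := norm_sub_sq (𝕜 := ℂ) (((2 * a ^ 2 : ℝ) : ℂ) • s) ((2 : ℂ) • A.symm (T (A s)))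
    rw [inner_smul_left, inner_smul_right, hsg, norm_smul, norm_smul, A.symm.norm_map,
      h.norm_start, ← ha] at h1
    have h2 : RCLike.re ((starRingEnd ℂ) ((2 * a ^ 2 : ℝ) : ℂ) * (2 * ((a ^ 2 : ℝ) : ℂ)))
        = 4 * a ^ 4 := by
      rw [Complex.conj_ofReal]
      rw [show (((2 * a ^ 2 : ℝ) : ℂ) * (2 * ((a ^ 2 : ℝ) : ℂ))) = ((4 * a ^ 4 : ℝ) : ℂ) by
        push_cast; ring]
      simp only [RCLike.re_to_complex, Complex.ofReal_re]
    rw [h2, Complex.norm_real, Complex.norm_ofNat, Real.norm_of_nonneg (by positivity)] at h1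
    refine le_of_sq_le_sq ?_ (by positivity)
    rw [h1]
    nlinarith [sq_nonneg (a ^ 2)]
  · rw [hw, map_sub, map_smul, map_smul, A.apply_symm_apply]

lemma norm_apply_le_one (h : AmplificationStep s T Q A B F β) : ‖T (A s)‖ ≤ 1 := by
  refine (IsSymmetricProjection.norm_apply_le h.proj_marked _).trans ?_
  rw [A.norm_map, h.norm_start]

/-- One step of amplitude amplification triples the amplitude, up to small errors. -/
lemma norm_amplify (h : AmplificationStep s T Q A B F β) (R : E ≃ₗᵢ[ℂ] E)
    (hR : ∀ v, R v = (2 : ℂ) • Q v - v) :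
    (3 - 4 * ‖T (A s)‖ ^ 2 - 4 * β) * ‖T (A s)‖ ≤ ‖T (A (R (A.symm (B (A s)))))‖ ∧
      ‖T (A (R (A.symm (B (A s)))))‖ ≤ (3 + 4 * β) * ‖T (A s)‖ := by
  obtain ⟨w, hwF, hsw, hwn, hv, hAw⟩ := h.exists_orthogonal
  set a : ℝ := ‖T (A s)‖ with ha
  have ha0 : 0 ≤ a := norm_nonneg _
  have ha1 : a ≤ 1 := h.norm_apply_le_one
  -- With `a = sin θ` the factor `3 - 4a²` is `sin 3θ / sin θ`; the term `2TAQw` is the only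
  -- deviation from exact amplification.
  have key : T (A (R (A.symm (B (A s)))))
      = ((3 - 4 * a ^ 2 : ℝ) : ℂ) • T (A s) + (2 : ℂ) • T (A (Q w)) := by
    rw [hv, hR, map_add, map_smul, h.fix]
    have : A ((2 : ℂ) • (((1 - 2 * a ^ 2 : ℝ) : ℂ) • s + Q w) -
        (((1 - 2 * a ^ 2 : ℝ) : ℂ) • s + w))
        = ((1 - 2 * a ^ 2 : ℝ) : ℂ) • A s + (2 : ℂ) • A (Q w) - A w := by
      simp only [map_sub, map_add, map_smul]
      module
    rw [this, hAw]
    simp only [map_sub, map_add, map_smul, IsSymmetricProjection.apply_apply h.proj_marked]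
    push_cast
    module
  -- Since `w` has length at most `2a`, the error is proportional to `a`. A relative bound is
  -- essential: the recursion starts from a tiny amplitude.
  have herr : ‖(2 : ℂ) • T (A (Q w))‖ ≤ 4 * β * a := by
    rw [norm_smul, Complex.norm_ofNat]
    have h1 := IsSymmetricProjection.norm_apply_le h.proj_marked (A (Q w))
    rw [A.norm_map] at h1
    have h2 := h.small w hwF hsw
    nlinarith [mul_le_mul_of_nonneg_left hwn h.nonneg]
  have hmain : ‖((3 - 4 * a ^ 2 : ℝ) : ℂ) • T (A s)‖ = |3 - 4 * a ^ 2| * a := by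
    rw [norm_smul, Complex.norm_real, Real.norm_eq_abs]
  rw [key]
  constructor
  · have := norm_sub_le_norm_add (((3 - 4 * a ^ 2 : ℝ) : ℂ) • T (A s)) ((2 : ℂ) • T (A (Q w)))
    nlinarith [le_abs_self (3 - 4 * a ^ 2)]
  · have := norm_add_le (((3 - 4 * a ^ 2 : ℝ) : ℂ) • T (A s)) ((2 : ℂ) • T (A (Q w)))
    have h3 : |3 - 4 * a ^ 2| ≤ 3 := by rw [abs_le]; constructor <;> nlinarith
    nlinarith

/-- If the test whether the state has returned to the start vector fails, then the marked
amplitude is large. -/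
lemma norm_failed_test (h : AmplificationStep s T Q A B F β) :
    2 * ‖T (A s)‖ * (1 - ‖T (A s)‖ ^ 2 - β) ≤
      ‖T (A (A.symm (B (A s)) - Q (A.symm (B (A s)))))‖ := by
  obtain ⟨w, hwF, hsw, hwn, hv, hAw⟩ := h.exists_orthogonal
  set a : ℝ := ‖T (A s)‖ with ha
  have ha0 : 0 ≤ a := norm_nonneg _
  have ha1 : a ≤ 1 := h.norm_apply_le_one
  -- `1 - Q` removes the component along `s`, so only `w - Qw` survives.
  have key : T (A (A.symm (B (A s)) - Q (A.symm (B (A s)))))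
      = ((2 * a ^ 2 - 2 : ℝ) : ℂ) • T (A s) - T (A (Q w)) := by
    rw [hv, map_add, map_smul, h.fix, add_sub_add_left_eq_sub, map_sub, hAw]
    simp only [map_sub, map_smul, IsSymmetricProjection.apply_apply h.proj_marked]
    push_cast
    module
  have herr : ‖T (A (Q w))‖ ≤ 2 * β * a := by
    have h1 := IsSymmetricProjection.norm_apply_le h.proj_marked (A (Q w))
    rw [A.norm_map] at h1
    have h2 := h.small w hwF hsw
    nlinarith [mul_le_mul_of_nonneg_left hwn h.nonneg]
  have hmain : ‖((2 * a ^ 2 - 2 : ℝ) : ℂ) • T (A s)‖ = (2 - 2 * a ^ 2) * a := by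
    rw [norm_smul, Complex.norm_real, Real.norm_eq_abs, abs_of_nonpos (by nlinarith)]
    ring
  rw [key]
  have := norm_sub_norm_le (((2 * a ^ 2 - 2 : ℝ) : ℂ) • T (A s)) (T (A (Q w)))
  nlinarith

end AmplificationStep

end Amplification

/-! ### Growth of the amplitudes along the recursion. -/

/-- The precision of the approximate projection at a level of the recursion. -/
noncomputable def precision (k : ℕ) : ℝ := (1 / 2) ^ (k + 5)

lemma precision_nonneg (k : ℕ) : 0 ≤ precision k := by unfold precision; positivity

lemma precision_le (k : ℕ) : precision k ≤ 1 / 32 := by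
  unfold precision
  calc ((1 : ℝ) / 2) ^ (k + 5) ≤ (1 / 2) ^ 5 :=
        pow_le_pow_of_le_one (by norm_num) (by norm_num) (by omega)
    _ = 1 / 32 := by norm_num

lemma sum_precision_le (k : ℕ) : ∑ i ∈ Finset.range k, precision i ≤ 1 / 16 := by
  have h : ∑ i ∈ Finset.range k, precision i = 1 / 16 - 2 * precision k := by
    induction k with
    | zero => simp [precision]; norm_num
    | succ k ih => rw [Finset.sum_range_succ, ih]; unfold precision; rw [pow_succ _ (k+1+4)]; ring
  rw [h]; linarith [precision_nonneg k]

section Growth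

variable {x : ℕ → ℝ} {n : ℕ} (h0 : ∀ k, 0 ≤ x k)
  (hlow : ∀ k < n, (3 - 4 * x k ^ 2 - 4 * precision k) * x k ≤ x (k + 1))

include h0 hlow

lemma growth_factor {k : ℕ} (hkn : k < n) (hk : x k < 1 / 10) : 5 / 2 * x k ≤ x (k + 1) := by
  refine le_trans ?_ (hlow k hkn)
  have := precision_le k
  have h2 : x k ^ 2 ≤ 1 / 100 := by nlinarith [h0 k]
  exact mul_le_mul_of_nonneg_right (by linarith) (h0 k)

/-- Growth by at least `5/2` per level gives a geometric series: `∑_{i ≥ 1} (2/5)^i = 2/3`. This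
constant limits the drift of the state during the skipped stages. -/
lemma growth_sum {k : ℕ} (hkn : k ≤ n) (hk : ∀ j < k, x j < 1 / 10) :
    ∑ j ∈ Finset.range k, x j ≤ 2 / 3 * x k := by
  induction k with
  | zero => simpa using h0 0
  | succ k ih =>
    rw [Finset.sum_range_succ]
    have h1 := ih (by omega) fun j hj => hk j (by omega)
    have h2 := growth_factor h0 hlow (by omega) (hk k (by omega))
    linarith

lemma growth_sum_sq {k : ℕ} (hkn : k ≤ n) (hk : ∀ j < k, x j < 1 / 10) :
    ∑ j ∈ Finset.range k, x j ^ 2 ≤ 1 / 3 * x k ^ 2 := by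
  induction k with
  | zero => simpa using sq_nonneg (x 0)
  | succ k ih =>
    rw [Finset.sum_range_succ]
    have h1 := ih (by omega) fun j hj => hk j (by omega)
    have h2 := growth_factor h0 hlow (by omega) (hk k (by omega))
    nlinarith [h0 k, h0 (k + 1)]

/-- Step `j` falls short of tripling by a factor `1 - y_j` with `y_j = 4/3 (x_j² + precision j)`,
and `∏ (1 - y_j) ≥ 1 - ∑ y_j`. -/
lemma growth_lower {k : ℕ} (hkn : k ≤ n) (hk : ∀ j < k, x j < 1 / 10) :
    3 ^ k * x 0 * (1 - ∑ j ∈ Finset.range k, 4 / 3 * (x j ^ 2 + precision j)) ≤ x k := by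
  induction k with
  | zero => simp
  | succ k ih =>
    have h1 := ih (by omega) fun j hj => hk j (by omega)
    have hp := precision_le k
    have hp0 := precision_nonneg k
    have hxk := hk k (by omega)
    have h2 : x k ^ 2 ≤ 1 / 100 := by nlinarith [h0 k]
    refine le_trans ?_ (hlow k hkn)
    rw [Finset.sum_range_succ]
    set σ := ∑ j ∈ Finset.range k, 4 / 3 * (x j ^ 2 + precision j)
    set y := 4 / 3 * (x k ^ 2 + precision k) with hy
    have hσ : 0 ≤ σ := Finset.sum_nonneg fun j _ => by
      have := precision_nonneg j; positivity
    have hy0 : 0 ≤ y := by positivity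
    have h3 : (3 - 4 * x k ^ 2 - 4 * precision k) = 3 * (1 - y) := by rw [hy]; ring
    have hpos : 0 ≤ 3 * (1 - y) := by rw [← h3]; linarith
    have hX : 0 ≤ (3 : ℝ) ^ k * x 0 := mul_nonneg (by positivity) (h0 0)
    rw [h3]
    calc 3 ^ (k + 1) * x 0 * (1 - (σ + y)) = 3 * (3 ^ k * x 0) * (1 - (σ + y)) := by ring
      _ ≤ 3 * (3 ^ k * x 0) * ((1 - σ) * (1 - y)) := by
        refine mul_le_mul_of_nonneg_left ?_ (by positivity)
        nlinarith [mul_nonneg hσ hy0]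
      _ = 3 * (1 - y) * (3 ^ k * x 0 * (1 - σ)) := by ring
      _ ≤ 3 * (1 - y) * x k := mul_le_mul_of_nonneg_left h1 hpos

/-- Amplitudes that grow by a factor of about three become large before they are overshot. -/
lemma exists_good_level (hup : ∀ k < n, x (k + 1) ≤ (3 + 4 * precision k) * x k)
    (hn : 1 ≤ 3 ^ n * x 0) :
    1 / 10 ≤ x 0 ∨ ∃ k ≤ n, 1 / 10 ≤ x k ∧ x k ≤ 1 / 3 ∧
      ∑ j ∈ Finset.range k, x j ≤ 2 / 3 * x k := by
  classical
  -- If all amplitudes stayed below `1/10`, the squares would sum to at most `1/300` and the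
  -- precisions to at most `1/16`. The total loss would be below `1/2`, and `3^n x_0 ≥ 1` would
  -- force `x_n ≥ 1/2`.
  have hex : ∃ k, k ≤ n ∧ 1 / 10 ≤ x k := by
    by_contra! hcon
    have hlt : ∀ j < n, x j < 1 / 10 := fun j hj => hcon j hj.le
    have h1 := growth_lower h0 hlow le_rfl hlt
    have h2 := growth_sum_sq h0 hlow le_rfl hlt
    have h3 := sum_precision_le n
    have h4 := hcon n le_rfl
    rw [← Finset.mul_sum, Finset.sum_add_distrib] at h1
    have h5 : x n ^ 2 ≤ 1 / 100 := by nlinarith [h0 n]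
    have h6 : 1 * (1 / 2 : ℝ) ≤ 3 ^ n * x 0 *
        (1 - 4 / 3 * (∑ j ∈ Finset.range n, x j ^ 2 + ∑ j ∈ Finset.range n, precision j)) :=
      mul_le_mul hn (by linarith) (by norm_num) (by linarith)
    linarith
  obtain ⟨hk, hk'⟩ := Nat.find_spec hex
  set k := Nat.find hex with hkdef
  have hmin : ∀ j < k, x j < 1 / 10 := fun j hj => by
    by_contra! hc
    exact Nat.find_min hex hj ⟨by omega, hc⟩
  rcases Nat.eq_zero_or_pos k with hz | hz
  · left; rwa [hz] at hk'
  · right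
    refine ⟨k, hk, hk', ?_, growth_sum h0 hlow hk hmin⟩
    -- The amplitude one level earlier is below `1/10` and grows by at most `3 + 1/8 < 10/3`, so the
    -- first level that reaches `1/10` stays below `1/3`.
    obtain ⟨j, hj⟩ : ∃ j, k = j + 1 := ⟨k - 1, by omega⟩
    rw [hj]
    have h1 := hup j (by omega)
    have h2 := hmin j (by omega)
    have h3 := precision_le j
    nlinarith [h0 j, precision_nonneg j]

end Growth

/-! ## Combining programs -/

namespace Program

variable {m : ℕ}

/-- Apply a list of gates, the head first. -/
def gates (L : List (Gate m)) (k : Program m) : Program m := L.foldr Program.gate k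

/-- Continue with `k` where `A` would report that there is no marked element. -/
def bind (k : Program m) : Program m → Program m
  | .reportEmpty => k
  | .setup A => .setup (bind k A)
  | .gate g A => .gate g (bind k A)
  | .measure i A₀ A₁ => .measure i (bind k A₀) (bind k A₁)
  | .observe A => .observe (bind k A)

/-- Repeat a program until it finds a marked element, at most `n` times. -/
def iterate (A : Program m) : ℕ → Program m
  | 0 => .reportEmpty
  | n + 1 => bind (iterate A n) A

section Cost

variable {S U C : ℝ}

lemma cost_gates (L : List (Gate m)) (k : Program m) :
    (gates L k).cost S U C = (L.map (Gate.cost U C)).sum + k.cost S U C := by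
  induction L with
  | nil => simp [gates]
  | cons g L ih =>
    simp only [gates, List.foldr_cons, Program.cost, List.map_cons, List.sum_cons] at ih ⊢
    rw [ih]; ring

lemma cost_bind (k A : Program m) :
    (bind k A).cost S U C = A.cost S U C + k.cost S U C := by
  induction A with
  | reportEmpty => simp [bind, cost]
  | setup A ih => simp only [bind, cost, ih]; ring
  | gate g A ih => simp only [bind, cost, ih]; ring
  | measure i A₀ A₁ ih₀ ih₁ => simp only [bind, cost, ih₀, ih₁, max_add_add_right]
  | observe A ih => simp only [bind, cost, ih]; ring

lemma cost_iterate (A : Program m) (n : ℕ) :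
    (iterate A n).cost S U C = n * A.cost S U C := by
  induction n with
  | zero => simp [iterate, cost]
  | succ n ih => simp only [iterate, cost_bind, ih]; push_cast; ring

end Cost

end Program

/-! ### Probabilities as squared norms. -/

section NormSq

variable {ι : Type*} [Fintype ι]

lemma normSq_nonneg (v : ι → ℂ) : 0 ≤ normSq v :=
  Finset.sum_nonneg fun _ _ => sq_nonneg _

lemma normSq_eq_norm_sq (v : ι → ℂ) : normSq v = ‖WithLp.toLp 2 v‖ ^ 2 := by
  rw [EuclideanSpace.norm_sq_eq]; rfl

lemma normSq_project_add (s : ι → Bool) (v : ι → ℂ) :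
    normSq (project (fun b => !s b) v) + normSq (project s v) = normSq v := by
  simp only [normSq, project, ← Finset.sum_add_distrib]
  refine Finset.sum_congr rfl fun i _ => ?_
  by_cases h : s i = true <;> simp [h]

lemma sum_normSq_project {κ : Type*} [Fintype κ] [DecidableEq κ] (f : ι → κ) (v : ι → ℂ) :
    ∑ x, normSq (project (fun b => decide (f b = x)) v) = normSq v := by
  simp only [normSq, project]
  rw [Finset.sum_comm]
  refine Finset.sum_congr rfl fun i _ => ?_
  rw [Finset.sum_eq_single (f i)]
  · simp
  · intro x _ hx; simp [hx.symm]
  · simp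

lemma normSq_mulVec [DecidableEq ι] {U : Matrix ι ι ℂ} (hU : U ∈ Matrix.unitaryGroup ι ℂ)
    (v : ι → ℂ) : normSq (U *ᵥ v) = normSq v := by
  have key : ∀ w : ι → ℂ, ((normSq w : ℝ) : ℂ) = star w ⬝ᵥ w := fun w => by
    simp only [normSq, dotProduct, Pi.star_apply, RCLike.star_def, RCLike.conj_mul]
    push_cast; rfl
  have h : ((normSq (U *ᵥ v) : ℝ) : ℂ) = ((normSq v : ℝ) : ℂ) := by
    rw [key, key, Matrix.star_mulVec, ← Matrix.dotProduct_mulVec, Matrix.mulVec_mulVec,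
      ← Matrix.star_eq_conjTranspose, (Unitary.mem_iff.mp hU).1, Matrix.one_mulVec]
  exact_mod_cast h

end NormSq

/-! ### Outcome probabilities of combined programs. -/

section Semantics

variable {X D : Type*} [Fintype X] [DecidableEq X] {d : X → D} {z : X}
  {P : Matrix X X ℝ} {p : X → ℝ} {m : ℕ}

lemma diagonal_sign_mem_unitaryGroup {ι : Type*} [Fintype ι] [DecidableEq ι] (c : ι → Prop)
    [DecidablePred c] :
    (Matrix.diagonal fun b => if c b then (-1 : ℂ) else 1) ∈ Matrix.unitaryGroup ι ℂ := by
  rw [Matrix.mem_unitaryGroup_iff, Matrix.star_eq_conjTranspose, Matrix.diagonal_conjTranspose,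
    Matrix.diagonal_mul_diagonal, ← Matrix.diagonal_one]
  congr 1
  funext b
  by_cases h : c b <;> simp [h]

lemma Gate.matrix_mem_unitaryGroup (W : WalkUpdates d z P p) (M : Finset X) (g : Gate m) :
    g.matrix W M ∈ Matrix.unitaryGroup (Basis d m) ℂ := by
  cases g with
  | ancilla G => exact Matrix.kronecker_mem_unitary (one_mem _) G.2
  | reflectLeft c => exact diagonal_sign_mem_unitaryGroup _
  | reflectRight c => exact diagonal_sign_mem_unitaryGroup _
  | updateRight => exact Matrix.kronecker_mem_unitary W.right.2 (one_mem _)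
  | updateRightInv =>
    exact Matrix.kronecker_mem_unitary (Unitary.star_mem W.right.2) (one_mem _)
  | updateLeft => exact Matrix.kronecker_mem_unitary W.left.2 (one_mem _)
  | updateLeftInv =>
    exact Matrix.kronecker_mem_unitary (Unitary.star_mem W.left.2) (one_mem _)
  | check => exact diagonal_sign_mem_unitaryGroup _

namespace Program

variable (W : WalkUpdates d z P p) (M : Finset X)

lemma run_nonneg (A : Program m) (v : Basis d m → ℂ) (o : Option X) : 0 ≤ A.run W M v o := by
  induction A generalizing v with
  | reportEmpty => simp only [run]; split_ifs <;> simp [normSq_nonneg]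
  | setup A ih => exact mul_nonneg (normSq_nonneg _) (ih _)
  | gate g A ih => exact ih _
  | measure i A₀ A₁ ih₀ ih₁ => exact add_nonneg (ih₀ _) (ih₁ _)
  | observe A ih =>
    refine Finset.sum_nonneg fun x _ => ?_
    split_ifs
    · exact normSq_nonneg _
    · exact le_rfl
    · exact ih _

lemma normSq_blankState : normSq (blankState d z m) = 1 := by
  rw [normSq, Finset.sum_eq_single ((withData d z, withData d z), fun _ => false)]
  · simp [blankState]
  · intro b _ hb; simp [blankState, hb]
  · simp

lemma normSq_setupState (hp : p ∈ stdSimplex ℝ X) : normSq (setupState d z p m) = 1 := by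
  rw [normSq, Fintype.sum_prod_type, Fintype.sum_prod_type, ← hp.2,
    ← (dataEquiv d).symm.sum_comp]
  refine Finset.sum_congr rfl fun x _ => ?_
  rw [Finset.sum_eq_single (withData d z), Finset.sum_eq_single (fun _ => false)]
  · simp only [setupState, and_self, if_true, Complex.norm_real, Real.norm_eq_abs, sq_abs]
    rw [Real.sq_sqrt (hp.1 _)]; rfl
  · intro a _ ha; simp [setupState, ha]
  · simp
  · intro a _ ha; simp [setupState, ha]
  · simp

/-- The outcome probabilities add up. -/
lemma sum_run (hp : p ∈ stdSimplex ℝ X) (A : Program m) (v : Basis d m → ℂ) :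
    A.run W M v none + ∑ x ∈ M, A.run W M v (some x) = normSq v := by
  induction A generalizing v with
  | reportEmpty => simp [run]
  | setup A ih =>
    simp only [run]
    rw [← Finset.mul_sum, ← mul_add, ih, normSq_setupState hp, mul_one]
  | gate g A ih =>
    simp only [run]
    rw [ih, normSq_mulVec (g.matrix_mem_unitaryGroup W M)]
  | measure i A₀ A₁ ih₀ ih₁ =>
    simp only [run, Finset.sum_add_distrib]
    rw [add_add_add_comm, ih₀, ih₁, normSq_project_add fun b : Basis d m => b.2 i]
  | observe A ih =>
    simp only [run]
    rw [Finset.sum_comm, ← Finset.sum_add_distrib,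
      ← sum_normSq_project (fun b : Basis d m => b.1.1.point) v]
    refine Finset.sum_congr rfl fun x _ => ?_
    by_cases hx : x ∈ M
    · simp [hx]
    · simp only [hx, if_false]; exact ih _

/-- The probability to find a marked element. -/
noncomputable def findProb (A : Program m) (v : Basis d m → ℂ) : ℝ :=
  ∑ x ∈ M, A.run W M v (some x)

lemma findProb_nonneg (A : Program m) (v : Basis d m → ℂ) : 0 ≤ A.findProb W M v :=
  Finset.sum_nonneg fun _ _ => run_nonneg W M A v _

/-- When the output law of `k` depends on its input only through the mass, the states left behind by
`A` need not be tracked: the probability that `A` reports emptiness suffices. -/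
lemma run_bind (k A : Program m) (q : Option X → ℝ)
    (hk : ∀ v x, k.run W M v (some x) = normSq v * q (some x)) (v : Basis d m → ℂ) (x : X) :
    (bind k A).run W M v (some x) =
      A.run W M v (some x) + A.run W M v none * q (some x) := by
  induction A generalizing v with
  | reportEmpty => simp [bind, run, hk]
  | setup A ih => simp only [bind, run, ih]; ring
  | gate g A ih => exact ih _
  | measure i A₀ A₁ ih₀ ih₁ => simp only [bind, run, ih₀, ih₁]; ring
  | observe A ih =>
    simp only [bind, run]
    rw [Finset.sum_mul, ← Finset.sum_add_distrib]
    refine Finset.sum_congr rfl fun y _ => ?_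
    by_cases hy : y ∈ M
    · simp [hy]
    · simp only [hy, if_false]; exact ih _

/-- Repetition makes the probability of failure small. -/
lemma one_sub_pow_le_findProb_iterate (hp : p ∈ stdSimplex ℝ X) (A : Program m) {c : ℝ}
    (hc : c ≤ (setup A).findProb W M (blankState d z m)) (hc1 : c ≤ 1) (n : ℕ) :
    (∃ q : Option X → ℝ, ∀ v x,
        (iterate (setup A) n).run W M v (some x) = normSq v * q (some x)) ∧
      1 - (1 - c) ^ n ≤ (iterate (setup A) n).findProb W M (blankState d z m) := by
  have hblank := normSq_blankState (d := d) (z := z) (m := m)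
  induction n with
  | zero =>
    exact ⟨⟨fun _ => 0, fun v x => by simp [iterate, run]⟩,
      by simp [iterate, findProb, run]⟩
  | succ n ih =>
    obtain ⟨⟨q, hq⟩, ih⟩ := ih
    -- Every nontrivial iterate begins with a setup, so its law forgets the input state. This fact
    -- is carried through the induction because `run_bind` needs it.
    refine ⟨⟨fun o => A.run W M (setupState d z p m) o +
      A.run W M (setupState d z p m) none * q o, fun v x => ?_⟩, ?_⟩
    · rw [iterate, run_bind W M _ _ q hq]
      simp only [run]; ring
    · have hmass := sum_run W M hp (setup A) (blankState d z m)
      have hsum : (iterate (setup A) (n + 1)).findProb W M (blankState d z m) =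
          (setup A).findProb W M (blankState d z m) +
            (setup A).run W M (blankState d z m) none *
              (iterate (setup A) n).findProb W M (blankState d z m) := by
        simp only [findProb, Finset.mul_sum]
        rw [← Finset.sum_add_distrib]
        refine Finset.sum_congr rfl fun x _ => ?_
        rw [iterate, run_bind W M _ _ q hq, hq, hblank, one_mul]
      have hmass2 := sum_run W M hp (iterate (setup A) n) (blankState d z m)
      have hn := run_nonneg W M (iterate (setup A) n) (blankState d z m) none
      rw [hsum]
      rw [hblank] at hmass hmass2
      change _ + findProb _ _ _ _ = _ at hmass
      change _ + findProb _ _ _ _ = _ at hmass2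
      set s := (setup A).findProb W M (blankState d z m)
      set f := (iterate (setup A) n).findProb W M (blankState d z m)
      have hN := run_nonneg W M (setup A) (blankState d z m) none
      have h1 : (setup A).run W M (blankState d z m) none = 1 - s := by linarith
      rw [h1] at hN ⊢
      have hf : f ≤ 1 := by linarith
      rw [pow_succ]
      nlinarith [mul_nonneg (sub_nonneg.2 hc) (sub_nonneg.2 hf),
        mul_le_mul_of_nonneg_left ih (sub_nonneg.2 hc1)]

/-- No false positives: only marked elements are ever output, so with `M` empty all the mass lies on
`none`. -/
lemma successProb_of_empty (hp : p ∈ stdSimplex ℝ X) (A : Program m) :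
    A.successProb W ∅ = 1 := by
  have := sum_run W ∅ hp A (blankState d z m)
  rw [Finset.sum_empty, add_zero] at this
  rw [successProb, if_pos rfl, this, normSq_blankState]

end Program

end Semantics

/-! ## Gates as isometries -/

noncomputable section

section Unitary

variable {ι : Type*} [Fintype ι] [DecidableEq ι]

/-- The isometry of Euclidean space given by a unitary matrix. -/
def unitaryIsometry :
    Matrix.unitaryGroup ι ℂ →* (EuclideanSpace ℂ ι ≃ₗᵢ[ℂ] EuclideanSpace ℂ ι) :=
  (Unitary.linearIsometryEquiv (𝕜 := ℂ) (H := EuclideanSpace ℂ ι)).toMonoidHom.comp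
    (Unitary.map
      { toFun := Matrix.toEuclideanCLM (n := ι) (𝕜 := ℂ)
        map_one' := map_one _
        map_mul' := map_mul _
        map_star' := map_star _ }).toMonoidHom

/-- The projection on the basis states that satisfy a condition, as a linear map. -/
def projectLin (s : ι → Bool) : EuclideanSpace ℂ ι →ₗ[ℂ] EuclideanSpace ℂ ι where
  toFun v := WithLp.toLp 2 (project s v.ofLp)
  map_add' u v := by ext i; by_cases h : s i = true <;> simp [project, h]
  map_smul' c v := by ext i; by_cases h : s i = true <;> simp [project, h]

lemma projectLin_apply (s : ι → Bool) (v : EuclideanSpace ℂ ι) (i : ι) :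
    projectLin s v i = if s i = true then v i else 0 := rfl

lemma projectLin_isSymmetricProjection (s : ι → Bool) :
    (projectLin s).IsSymmetricProjection where
  isIdempotentElem := by
    ext v i
    simp only [Module.End.mul_apply, projectLin_apply]
    split_ifs <;> rfl
  isSymmetric := fun u v => by
    simp only [PiLp.inner_apply, projectLin_apply]
    refine Finset.sum_congr rfl fun i _ => ?_
    split_ifs <;> simp

end Unitary

/-! ### Gates on the ancilla qubits, inverses and costs. -/

section Ancilla

variable {m : ℕ}

/-- The Hadamard matrix on qubit `j`. -/
def hadamardMatrix (j : Fin m) : Matrix (Qubits m) (Qubits m) ℂ := fun a b =>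
  ∑ c : Bool, if b = Function.update a j c then
    (if (a j && c) = true then -(((√2)⁻¹ : ℝ) : ℂ) else (((√2)⁻¹ : ℝ) : ℂ)) else 0

lemma sum_hadamardMatrix_smul {V : Type*} [AddCommGroup V] [Module ℂ V] (j : Fin m)
    (a : Qubits m) (f : Qubits m → V) :
    ∑ b, hadamardMatrix j a b • f b = (((√2)⁻¹ : ℝ) : ℂ) • (f (Function.update a j false) +
      (if a j = true then (-1 : ℂ) else 1) • f (Function.update a j true)) := by
  simp only [hadamardMatrix, Finset.sum_smul, ite_smul, zero_smul]
  rw [Finset.sum_comm]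
  simp only [Finset.sum_ite_eq', Finset.mem_univ, if_true, Fintype.sum_bool, Bool.and_true,
    Bool.and_false]
  split_ifs <;> simp_all [add_comm]

lemma hadamardMatrix_symm (j : Fin m) (a b : Qubits m) :
    hadamardMatrix j a b = hadamardMatrix j b a := by
  have key : ∀ a b : Qubits m, hadamardMatrix j a b =
      if b = Function.update a j (b j) then
        (if (a j && b j) = true then -(((√2)⁻¹ : ℝ) : ℂ) else (((√2)⁻¹ : ℝ) : ℂ)) else 0 := by
    intro a b
    rw [hadamardMatrix, Finset.sum_eq_single (b j)]
    · intro c _ hc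
      rw [if_neg]
      intro h
      exact hc (by rw [h, Function.update_self])
    · simp
  have hiff : ∀ a b : Qubits m, b = Function.update a j (b j) → a = Function.update b j (a j) := by
    intro a b h
    rw [h, Function.update_idem, Function.update_eq_self]
  rw [key, key, Bool.and_comm]
  by_cases h : b = Function.update a j (b j)
  · rw [if_pos h, if_pos (hiff _ _ h)]
  · rw [if_neg h, if_neg fun h' => h (hiff _ _ h')]

lemma hadamardMatrix_mem_unitaryGroup (j : Fin m) :
    hadamardMatrix j ∈ Matrix.unitaryGroup (Qubits m) ℂ := by
  have hstar : star (hadamardMatrix j) = hadamardMatrix j := by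
    ext a b
    rw [Matrix.star_apply, hadamardMatrix_symm]
    simp only [hadamardMatrix, star_sum]
    refine Finset.sum_congr rfl fun c _ => ?_
    split_ifs <;> simp
  rw [Matrix.mem_unitaryGroup_iff, hstar]
  have hr : (((√2)⁻¹ : ℝ) : ℂ) * (((√2)⁻¹ : ℝ) : ℂ) = 1 / 2 := by
    rw [← Complex.ofReal_mul, ← mul_inv, Real.mul_self_sqrt (by norm_num)]
    push_cast; norm_num
  ext a b
  rw [Matrix.mul_apply]
  have h := sum_hadamardMatrix_smul j a fun c => hadamardMatrix j c b
  simp only [smul_eq_mul] at h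
  rw [h]
  simp only [hadamardMatrix, Function.update_self, Function.update_idem, Fintype.sum_bool,
    Bool.false_and, Bool.true_and, Matrix.one_apply]
  have ha : a = Function.update a j (a j) := (Function.update_eq_self j a).symm
  have hne : Function.update a j true ≠ Function.update a j false := fun h => by
    simpa using congrFun h j
  rcases hj : a j with _ | _ <;> rw [hj] at ha
  · have hab : a = b ↔ b = Function.update a j false := by rw [← ha, eq_comm]
    by_cases h1 : b = Function.update a j true
    · subst h1; simp [hab, hne]
    · by_cases h2 : b = Function.update a j false
      · rw [if_pos (hab.2 h2), h2]; simp [hne.symm]; rw [Complex.ofReal_inv] at hr; linear_combination 2 * hr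
      · simp [hab, h1, h2]
  · have hab : a = b ↔ b = Function.update a j true := by rw [← ha, eq_comm]
    by_cases h1 : b = Function.update a j true
    · rw [if_pos (hab.2 h1), h1]; simp [hne]; rw [Complex.ofReal_inv] at hr; linear_combination 2 * hr
    · by_cases h2 : b = Function.update a j false
      · subst h2; simp [hab, hne.symm]
      · simp [hab, h1, h2]

/-- The permutation of the basis states that flips qubit `j` if another qubit is not blank. -/
def flipUnlessBlank (j : Fin m) (a : Qubits m) : Qubits m :=
  if ∀ i, i ≠ j → a i = false then a else Function.update a j (!a j)

lemma flipUnlessBlank_flipUnlessBlank (j : Fin m) (a : Qubits m) :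
    flipUnlessBlank j (flipUnlessBlank j a) = a := by
  by_cases h : ∀ i, i ≠ j → a i = false
  · rw [flipUnlessBlank, flipUnlessBlank, if_pos h, if_pos h]
  · have h' : ¬ ∀ i, i ≠ j → Function.update a j (!a j) i = false := fun hc => h fun i hi => by
      simpa [Function.update_of_ne hi] using hc i hi
    rw [flipUnlessBlank, flipUnlessBlank, if_neg h, if_neg h']
    simp

/-- The matrix of `flipUnlessBlank`. -/
def flipMatrix (j : Fin m) : Matrix (Qubits m) (Qubits m) ℂ := fun a b =>
  if b = flipUnlessBlank j a then 1 else 0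

lemma flipMatrix_mem_unitaryGroup (j : Fin m) :
    flipMatrix j ∈ Matrix.unitaryGroup (Qubits m) ℂ := by
  rw [Matrix.mem_unitaryGroup_iff]
  ext a b
  rw [Matrix.mul_apply]
  have hinj : flipUnlessBlank j a = flipUnlessBlank j b ↔ a = b :=
    ⟨fun h => by
      rw [← flipUnlessBlank_flipUnlessBlank j a, h, flipUnlessBlank_flipUnlessBlank],
      fun h => h ▸ rfl⟩
  simp only [flipMatrix, Matrix.star_apply, ite_mul, one_mul, zero_mul, Finset.sum_ite_eq',
    Finset.mem_univ, if_true, hinj, Matrix.one_apply]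
  split_ifs <;> simp

/-- The Hadamard gate on qubit `j`. -/
def hadamardGate (j : Fin m) : Gate m := .ancilla ⟨_, hadamardMatrix_mem_unitaryGroup j⟩

/-- The gate that flips qubit `j` if another qubit is not blank. -/
def flipGate (j : Fin m) : Gate m := .ancilla ⟨_, flipMatrix_mem_unitaryGroup j⟩

/-- The reflection through the states with blank ancilla qubits. -/
def blankGate (m : ℕ) : Gate m :=
  .ancilla ⟨_, diagonal_sign_mem_unitaryGroup fun a : Qubits m => a ≠ fun _ => false⟩

/-- The inverse of a gate. -/
def Gate.inv : Gate m → Gate m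
  | .ancilla G => .ancilla G⁻¹
  | .reflectLeft c => .reflectLeft c
  | .reflectRight c => .reflectRight c
  | .updateRight => .updateRightInv
  | .updateRightInv => .updateRight
  | .updateLeft => .updateLeftInv
  | .updateLeftInv => .updateLeft
  | .check => .check

/-- The inverse of a list of gates. -/
def invList (L : List (Gate m)) : List (Gate m) := (L.map Gate.inv).reverse

/-- The cost of a list of gates. -/
def listCost (U C : ℝ) (L : List (Gate m)) : ℝ := (L.map (Gate.cost U C)).sum

lemma listCost_append (U C : ℝ) (L L' : List (Gate m)) :
    listCost U C (L ++ L') = listCost U C L + listCost U C L' := by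
  simp [listCost]

lemma listCost_invList (U C : ℝ) (L : List (Gate m)) :
    listCost U C (invList L) = listCost U C L := by
  rw [listCost, invList, List.map_reverse, List.sum_reverse, List.map_map]
  congr 2
  funext g
  cases g <;> rfl

end Ancilla

/-! ### The action of circuits, one ancilla configuration at a time. -/

section Semantics

variable {X D : Type*} [Fintype X] [DecidableEq X] {d : X → D} {z : X}
  {P : Matrix X X ℝ} {p : X → ℝ} {m : ℕ} (W : WalkUpdates d z P p) (M : Finset X)

/-- The Hilbert space of the registers and the ancilla qubits. -/
abbrev StateSpace (d : X → D) (m : ℕ) : Type _ := EuclideanSpace ℂ (Basis d m)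

/-- The action of a gate. -/
def Gate.act (g : Gate m) : StateSpace d m ≃ₗᵢ[ℂ] StateSpace d m :=
  unitaryIsometry ⟨g.matrix W M, g.matrix_mem_unitaryGroup W M⟩

lemma Gate.act_apply (g : Gate m) (v : StateSpace d m) :
    g.act W M v = WithLp.toLp 2 (g.matrix W M *ᵥ v.ofLp) := rfl

/-- The action of a list of gates. -/
def actList : List (Gate m) → (StateSpace d m ≃ₗᵢ[ℂ] StateSpace d m)
  | [] => 1
  | g :: L => actList L * g.act W M

lemma actList_nil (v : StateSpace d m) : actList W M [] v = v := rfl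

lemma actList_cons (g : Gate m) (L : List (Gate m)) (v : StateSpace d m) :
    actList W M (g :: L) v = actList W M L (g.act W M v) := rfl

lemma actList_append (L L' : List (Gate m)) :
    actList W M (L ++ L') = actList W M L' * actList W M L := by
  induction L with
  | nil => rfl
  | cons g L ih => rw [List.cons_append, actList, actList, ih, mul_assoc]

lemma actList_append_apply (L L' : List (Gate m)) (v : StateSpace d m) :
    actList W M (L ++ L') v = actList W M L' (actList W M L v) := by
  rw [actList_append]; rfl

lemma Gate.inv_act (g : Gate m) : g.inv.act W M = (g.act W M)⁻¹ := by
  rw [Gate.act, Gate.act, ← map_inv]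
  congr 1
  apply Subtype.ext
  change _ = star (g.matrix W M)
  rw [Matrix.star_eq_conjTranspose]
  have hdiag : ∀ (c : Basis d m → Prop) [DecidablePred c],
      (Matrix.diagonal fun b => if c b then (-1 : ℂ) else 1)ᴴ =
        Matrix.diagonal fun b => if c b then (-1 : ℂ) else 1 := fun c _ => by
    rw [Matrix.diagonal_conjTranspose]
    congr 1
    funext b
    by_cases h : c b <;> simp [h]
  cases g with
  | ancilla G =>
    simp only [Gate.inv, Gate.matrix, Matrix.conjTranspose_kronecker, Matrix.conjTranspose_one]
    rfl
  | reflectLeft c => exact (hdiag _).symm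
  | reflectRight c => exact (hdiag _).symm
  | check => exact (hdiag _).symm
  | _ => simp [Gate.inv, Gate.matrix, Matrix.conjTranspose_kronecker]

lemma actList_invList (L : List (Gate m)) : actList W M (invList L) = (actList W M L)⁻¹ := by
  induction L with
  | nil => rfl
  | cons g L ih =>
    rw [invList, List.map_cons, List.reverse_cons, actList_append, ← invList, ih, actList,
      actList, actList, one_mul, Gate.inv_act, mul_inv_rev]

lemma actList_invList_apply (L : List (Gate m)) (v : StateSpace d m) :
    actList W M (invList L) v = (actList W M L).symm v := by
  rw [actList_invList]; rfl

lemma Program.run_gates_eq (L : List (Gate m)) (k : Program m) (v : StateSpace d m)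
    (o : Option X) :
    (Program.gates L k).run W M v.ofLp o = k.run W M (actList W M L v).ofLp o := by
  induction L generalizing v with
  | nil => rfl
  | cons g L ih => exact ih (g.act W M v)

/-- The state of the registers belonging to a basis state of the ancilla qubits. -/
def slice (v : StateSpace d m) (a : Qubits m) : DataState d × DataState d → ℂ :=
  fun q => v (q, a)

lemma ext_slice {u v : StateSpace d m} (h : ∀ a, slice u a = slice v a) : u = v := by
  ext ⟨q, a⟩
  exact congrFun (h a) q

lemma slice_ancilla (G : Matrix.unitaryGroup (Qubits m) ℂ) (v : StateSpace d m)
    (a : Qubits m) :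
    slice ((Gate.ancilla G).act W M v) a = ∑ b, G.1 a b • slice v b := by
  funext q
  rw [slice, Gate.act_apply]
  simp only [Gate.matrix, Matrix.mulVec, dotProduct, Matrix.kroneckerMap_apply,
    Fintype.sum_prod_type, Finset.sum_apply, Pi.smul_apply, slice, smul_eq_mul]
  rw [Fintype.sum_eq_single q.1, Fintype.sum_eq_single q.2]
  · simp
  · intro y hy
    refine Finset.sum_eq_zero fun b _ => ?_
    rw [Matrix.one_apply_ne (fun h => hy (congrArg Prod.snd h).symm)]
    simp
  · intro y hy
    refine Finset.sum_eq_zero fun y' _ => Finset.sum_eq_zero fun b _ => ?_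
    rw [Matrix.one_apply_ne (fun h => hy (congrArg Prod.fst h).symm)]
    simp

lemma slice_kronecker_one (G : Matrix (DataState d × DataState d) (DataState d × DataState d) ℂ)
    (v : StateSpace d m) (a : Qubits m) :
    slice (WithLp.toLp 2 ((G ⊗ₖ (1 : Matrix (Qubits m) (Qubits m) ℂ)) *ᵥ v.ofLp)) a =
      G *ᵥ slice v a := by
  funext q
  simp only [slice, Matrix.mulVec, dotProduct, Matrix.kroneckerMap_apply, Fintype.sum_prod_type]
  refine Finset.sum_congr rfl fun y _ => Finset.sum_congr rfl fun y' _ => ?_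
  rw [Fintype.sum_eq_single a]
  · simp
  · intro b hb
    rw [Matrix.one_apply_ne hb.symm]
    simp

/-- The reflection through the states with blank left register. -/
def reflLeft (d : X → D) (z : X) :
    Matrix (DataState d × DataState d) (DataState d × DataState d) ℂ :=
  Matrix.diagonal fun q => if q.1 ≠ withData d z then -1 else 1

/-- The reflection through the states with blank right register. -/
def reflRight (d : X → D) (z : X) :
    Matrix (DataState d × DataState d) (DataState d × DataState d) ℂ :=
  Matrix.diagonal fun q => if q.2 ≠ withData d z then -1 else 1

lemma slice_reflectLeft (c : Qubits m → Bool) (v : StateSpace d m) (a : Qubits m) :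
    slice ((Gate.reflectLeft c).act W M v) a =
      if c a = true then reflLeft d z *ᵥ slice v a else slice v a := by
  funext q
  rw [slice, Gate.act_apply]
  simp only [Gate.matrix, Matrix.mulVec_diagonal, reflLeft]
  by_cases h : c a = true
  · simp [h, Matrix.mulVec_diagonal, slice]
  · simp [h, slice]

lemma slice_reflectRight (c : Qubits m → Bool) (v : StateSpace d m) (a : Qubits m) :
    slice ((Gate.reflectRight c).act W M v) a =
      if c a = true then reflRight d z *ᵥ slice v a else slice v a := by
  funext q
  rw [slice, Gate.act_apply]
  simp only [Gate.matrix, Matrix.mulVec_diagonal, reflRight]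
  by_cases h : c a = true
  · simp [h, Matrix.mulVec_diagonal, slice]
  · simp [h, slice]

lemma slice_hadamardGate (j : Fin m) (v : StateSpace d m) (a : Qubits m) :
    slice ((hadamardGate j).act W M v) a = (((√2)⁻¹ : ℝ) : ℂ) •
      (slice v (Function.update a j false) +
        (if a j = true then (-1 : ℂ) else 1) • slice v (Function.update a j true)) := by
  rw [hadamardGate, slice_ancilla, sum_hadamardMatrix_smul]

lemma slice_flipGate (j : Fin m) (v : StateSpace d m) (a : Qubits m) :
    slice ((flipGate j).act W M v) a = slice v (flipUnlessBlank j a) := by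
  rw [flipGate, slice_ancilla]
  simp [flipMatrix]

lemma slice_check (v : StateSpace d m) (a : Qubits m) :
    slice (Gate.check.act W M v) a =
      fun q => if q.1.point ∈ M then - slice v a q else slice v a q := by
  funext q
  rw [slice, Gate.act_apply]
  simp only [Gate.matrix, Matrix.mulVec_diagonal, slice]
  split_ifs <;> simp

/-- The projection on the states with marked left register. -/
def markedProj (d : X → D) (m : ℕ) : StateSpace d m →ₗ[ℂ] StateSpace d m :=
  projectLin fun b => decide (b.1.1.point ∈ M)

/-- The projection on the states with blank ancilla qubits. -/
def blankProj (d : X → D) (m : ℕ) : StateSpace d m →ₗ[ℂ] StateSpace d m :=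
  projectLin fun b => decide (b.2 = fun _ => false)

lemma check_act_apply (v : StateSpace d m) :
    Gate.check.act W M v = v - (2 : ℂ) • markedProj M d m v := by
  ext ⟨q, a⟩
  have h := congrFun (slice_check W M v a) q
  simp only [slice] at h
  rw [h]
  simp only [markedProj, PiLp.sub_apply, PiLp.smul_apply, projectLin_apply, decide_eq_true_eq]
  split_ifs
  · change -(v (q, a)) = v (q, a) - 2 * v (q, a); ring
  · simp

lemma blankGate_act_apply (v : StateSpace d m) :
    (blankGate m).act W M v = (2 : ℂ) • blankProj d m v - v := by
  ext ⟨q, a⟩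
  have h := congrFun (slice_ancilla W M ⟨_, diagonal_sign_mem_unitaryGroup
    fun a : Qubits m => a ≠ fun _ => false⟩ v a) q
  simp only [slice] at h
  rw [blankGate, h, Finset.sum_apply, Fintype.sum_eq_single a]
  · simp only [blankProj, PiLp.sub_apply, PiLp.smul_apply, projectLin_apply, decide_eq_true_eq,
      Matrix.diagonal_apply_eq]
    by_cases ha : a = fun _ => false
    · simp [ha, slice]; ring
    · simp [ha, slice]
  · intro b hb
    simp [Matrix.diagonal_apply_ne _ hb.symm]

/-! ### States with blank qubits -/

/-- The states whose qubits from `N` on are blank. -/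
def blankFrom (d : X → D) (m N : ℕ) : Submodule ℂ (StateSpace d m) where
  carrier := {v | ∀ a : Qubits m, (∃ j : Fin m, N ≤ j ∧ a j = true) → slice v a = 0}
  add_mem' {u v} hu hv a ha := by
    have h1 := hu a ha
    have h2 := hv a ha
    funext q
    have h1 := congrFun h1 q
    have h2 := congrFun h2 q
    simp only [slice, Pi.zero_apply] at h1 h2 ⊢
    rw [PiLp.add_apply, h1, h2, add_zero]
  zero_mem' a _ := rfl
  smul_mem' c v hv a ha := by
    funext q
    have h1 := congrFun (hv a ha) q
    simp only [slice, Pi.zero_apply] at h1 ⊢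
    rw [PiLp.smul_apply, h1, smul_zero]

lemma blankFrom_mono {N N' : ℕ} (h : N ≤ N') : blankFrom d m N ≤ blankFrom d m N' :=
  fun _ hv a ⟨j, hj, ha⟩ => hv a ⟨j, h.trans hj, ha⟩

/-- The isometries that preserve the states whose qubits from `N` on are blank. -/
def blankStabilizer (d : X → D) (m N : ℕ) : Subgroup (StateSpace d m ≃ₗᵢ[ℂ] StateSpace d m) where
  carrier := {A | ∀ v ∈ blankFrom d m N, A v ∈ blankFrom d m N}
  mul_mem' {A B} hA hB v hv := hA _ (hB v hv)
  one_mem' v hv := hv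
  inv_mem' {A} hA v hv := by
    -- In finite dimension an injective map of a subspace into itself is onto, so preserving the
    -- subspace passes to inverses.
    have hle : (blankFrom d m N).map A.toLinearEquiv.toLinearMap ≤ blankFrom d m N := by
      rintro _ ⟨u, hu, rfl⟩
      exact hA u hu
    have heq := Submodule.eq_of_le_of_finrank_eq hle
      (LinearEquiv.finrank_map_eq A.toLinearEquiv _)
    rw [← heq] at hv
    obtain ⟨u, hu, rfl⟩ := hv
    change A.symm (A u) ∈ _
    rwa [A.symm_apply_apply]

lemma mem_blankStabilizer_of_slice {N : ℕ} {A : StateSpace d m ≃ₗᵢ[ℂ] StateSpace d m}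
    (h : ∀ v a, slice v a = 0 → slice (A v) a = 0) : A ∈ blankStabilizer d m N :=
  fun v hv a ha => h v a (hv a ha)

lemma hadamardGate_mem_blankStabilizer {N : ℕ} {j : Fin m} (hj : (j : ℕ) < N) :
    (hadamardGate j).act W M ∈ blankStabilizer d m N := by
  rintro v hv a ⟨i, hi, ha⟩
  have hne : i ≠ j := fun h => by subst h; omega
  rw [slice_hadamardGate, hv _ ⟨i, hi, by rwa [Function.update_of_ne hne]⟩,
    hv _ ⟨i, hi, by rwa [Function.update_of_ne hne]⟩]
  simp

lemma blankGate_mem_blankStabilizer (N : ℕ) : (blankGate m).act W M ∈ blankStabilizer d m N := by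
  refine mem_blankStabilizer_of_slice fun v a h => ?_
  rw [blankGate, slice_ancilla, Fintype.sum_eq_single a]
  · rw [h, smul_zero]
  · intro b hb
    simp [Matrix.diagonal_apply_ne _ hb.symm]

lemma check_mem_blankStabilizer (N : ℕ) :
    (Gate.check : Gate m).act W M ∈ blankStabilizer d m N := by
  refine mem_blankStabilizer_of_slice fun v a h => ?_
  rw [slice_check, h]
  funext q
  simp

end Semantics

end

noncomputable section

/-! ## The doubling recursion of the Chebyshev polynomials -/

/-- The Chebyshev polynomial of degree `2 ^ j`, evaluated at `t`. -/
def doubling (t : ℝ) : ℕ → ℝ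
  | 0 => t
  | j + 1 => 2 * doubling t j ^ 2 - 1

/-- With `t = cos θ`, replacing `t` by `2t² - 1 = cos 2θ` is one step along the recursion. It
converts walk phases into discriminant eigenvalues. -/
lemma doubling_shift (t : ℝ) (j : ℕ) : doubling (2 * t ^ 2 - 1) j = doubling t (j + 1) := by
  induction j with
  | zero => rfl
  | succ j ih => rw [doubling, ih]; rfl

/-- For `t = cos θ` this is `∏_{j<n} cos(2^j θ) = sin(2^n θ) / (2^n sin θ)`, squared and cleared of
denominators. -/
lemma prod_doubling (t : ℝ) (n : ℕ) :
    ((List.range n).map fun j => doubling t j ^ 2).prod * (4 ^ n * (1 - t ^ 2)) =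
      1 - doubling t n ^ 2 := by
  induction n with
  | zero => simp [doubling]
  | succ n ih =>
    rw [List.range_succ, List.map_append, List.prod_append, doubling]
    simp only [List.map_cons, List.map_nil, List.prod_cons, List.prod_nil, mul_one]
    rw [pow_succ]
    linear_combination 4 * doubling t n ^ 2 * ih

/-- The exponents of the powers of two in the products of walk operators. -/
def exponents (n s : ℕ) : List ℕ := (List.replicate s (List.range n)).flatten

lemma length_exponents (n s : ℕ) : (exponents n s).length = s * n := by
  simp [exponents]

/-- By the telescoping product, each of the `s` blocks contributes at most `1 / (4^n (1 - t²)) ≤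
1/4`. The bound concerns squared norms, so a block halves the norm. -/
lemma prod_exponents_le {t δ : ℝ} {n : ℕ} (ht : δ ≤ 1 - t ^ 2)
    (hn : 4 ≤ 4 ^ n * δ) (s : ℕ) :
    ((exponents n s).map fun j => (1 + doubling (2 * t ^ 2 - 1) j) / 2).prod ≤
      ((1 / 2) ^ s) ^ 2 := by
  have hfun : (fun j => (1 + doubling (2 * t ^ 2 - 1) j) / 2) = fun j => doubling t j ^ 2 := by
    funext j
    rw [doubling_shift, doubling]; ring
  have hprod : ((exponents n s).map fun j => doubling t j ^ 2).prod =
      ((List.range n).map fun j => doubling t j ^ 2).prod ^ s := by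
    rw [exponents, List.map_flatten, List.prod_flatten, List.map_replicate, List.map_replicate,
      List.prod_replicate]
  have h0 : 0 ≤ ((List.range n).map fun j => doubling t j ^ 2).prod :=
    List.prod_nonneg fun a ha => by
      obtain ⟨j, -, rfl⟩ := List.mem_map.1 ha
      positivity
  have h1 : ((List.range n).map fun j => doubling t j ^ 2).prod ≤ 1 / 4 := by
    have h := prod_doubling t n
    have h2 : (4 : ℝ) ≤ 4 ^ n * (1 - t ^ 2) :=
      hn.trans (mul_le_mul_of_nonneg_left ht (by positivity))
    nlinarith [sq_nonneg (doubling t n)]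
  rw [hfun, hprod]
  refine (pow_le_pow_left₀ h0 h1 s).trans (le_of_eq ?_)
  rw [← pow_mul, mul_comm, pow_mul]; norm_num

/-! ## Products of averages of powers of a unitary matrix -/

section Average

variable {ι : Type*} [Fintype ι] [DecidableEq ι]

/-- The product of the averages `(1 + V ^ (2 ^ j)) / 2`. -/
def averageProduct (V : Matrix ι ι ℂ) : List ℕ → Matrix ι ι ℂ
  | [] => 1
  | j :: js => averageProduct V js * ((1 / 2 : ℂ) • (1 + V ^ (2 ^ j)))

variable {V : Matrix ι ι ℂ} (hV : V * Vᴴ = 1) (hV' : Vᴴ * V = 1)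

include hV hV'

/-- Squaring `V^m + (V*)^m` and subtracting `2` doubles `m`, as in the Chebyshev recursion. Only
eigenvectors of `V + V*` are used, so `V` need not be diagonalized. -/
lemma pow_add_pow_mulVec {c : ℝ} {x : ι → ℂ} (hx : (V + Vᴴ) *ᵥ x = ((2 * c : ℝ) : ℂ) • x)
    (j : ℕ) : (V ^ (2 ^ j) + Vᴴ ^ (2 ^ j)) *ᵥ x = ((2 * doubling c j : ℝ) : ℂ) • x := by
  induction j with
  | zero => simpa [doubling] using hx
  | succ j ih =>
    have hcomm : Commute V Vᴴ := by rw [Commute, SemiconjBy, hV, hV']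
    have h1 : V ^ (2 ^ j) * Vᴴ ^ (2 ^ j) = 1 := by rw [← hcomm.mul_pow, hV, one_pow]
    have h2 : Vᴴ ^ (2 ^ j) * V ^ (2 ^ j) = 1 := by rw [← hcomm.symm.mul_pow, hV', one_pow]
    have h3 : V ^ (2 ^ (j + 1)) + Vᴴ ^ (2 ^ (j + 1)) =
        (V ^ (2 ^ j) + Vᴴ ^ (2 ^ j)) * (V ^ (2 ^ j) + Vᴴ ^ (2 ^ j)) - (2 : ℂ) • 1 := by
      rw [add_mul, mul_add, mul_add, h1, h2, pow_succ 2 j, pow_mul, pow_mul, two_smul, sq, sq]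
      abel
    rw [h3, Matrix.sub_mulVec, ← Matrix.mulVec_mulVec, ih, Matrix.mulVec_smul, ih,
      Matrix.smul_mulVec, Matrix.one_mulVec, smul_smul, ← sub_smul, doubling]
    congr 1
    push_cast; ring

/-- Each average `G` commutes with `V + V*`, so `Gx` is again an eigenvector for the same value, and
`G*G = (2 + V^(2^j) + V*^(2^j)) / 4` acts on `x` as a scalar. The factors can therefore be peeled
off one by one. -/
lemma averageProduct_mulVec {c : ℝ} {x : ι → ℂ} (hx : (V + Vᴴ) *ᵥ x = ((2 * c : ℝ) : ℂ) • x)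
    (js : List ℕ) :
    (averageProduct V js)ᴴ *ᵥ (averageProduct V js *ᵥ x) =
      (((js.map fun j => (1 + doubling c j) / 2).prod : ℝ) : ℂ) • x := by
  induction js generalizing x with
  | nil => simp [averageProduct]
  | cons j js ih =>
    set G : Matrix ι ι ℂ := (1 / 2 : ℂ) • (1 + V ^ (2 ^ j)) with hG
    have hcomm : Commute V Vᴴ := by rw [Commute, SemiconjBy, hV, hV']
    have hGc : Commute (V + Vᴴ) G := by
      refine Commute.smul_right (Commute.add_right (Commute.one_right _) ?_) _
      exact Commute.pow_right (Commute.add_left (Commute.refl V) hcomm.symm) _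
    have hGx : (V + Vᴴ) *ᵥ (G *ᵥ x) = ((2 * c : ℝ) : ℂ) • (G *ᵥ x) := by
      rw [Matrix.mulVec_mulVec, hGc.eq, ← Matrix.mulVec_mulVec, hx, Matrix.mulVec_smul]
    have hGG : Gᴴ * G = (1 / 4 : ℂ) • ((2 : ℂ) • 1 + (V ^ (2 ^ j) + Vᴴ ^ (2 ^ j))) := by
      have h2 : Vᴴ ^ (2 ^ j) * V ^ (2 ^ j) = 1 := by rw [← hcomm.symm.mul_pow, hV', one_pow]
      rw [hG, Matrix.conjTranspose_smul, Matrix.conjTranspose_add, Matrix.conjTranspose_one,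
        Matrix.conjTranspose_pow, smul_mul_smul_comm, add_mul, mul_add, mul_add, h2, two_smul]
      have : star (1 / 2 : ℂ) * (1 / 2) = 1 / 4 := by
        rw [show (1 / 2 : ℂ) = ((1 / 2 : ℝ) : ℂ) by push_cast; rfl, RCLike.star_def,
          Complex.conj_ofReal]
        push_cast; norm_num
      rw [this]
      congr 1
      simp only [one_mul, mul_one]
      abel
    have hGGx : Gᴴ *ᵥ (G *ᵥ x) = (((1 + doubling c j) / 2 : ℝ) : ℂ) • x := by
      rw [Matrix.mulVec_mulVec, hGG, Matrix.smul_mulVec, Matrix.add_mulVec,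
        pow_add_pow_mulVec hV hV' hx, Matrix.smul_mulVec, Matrix.one_mulVec, ← add_smul,
        smul_smul]
      congr 1
      push_cast; ring
    rw [averageProduct, ← hG, Matrix.conjTranspose_mul, ← Matrix.mulVec_mulVec,
      ← Matrix.mulVec_mulVec, ih hGx, Matrix.mulVec_smul, hGGx, smul_smul, List.map_cons,
      List.prod_cons]
    congr 1
    push_cast; ring

open scoped ComplexOrder in
-- For unitary `V`, `(V - 1)*(V - 1) = 2 - (V + V*)` annihilates `x`, hence so does `V - 1`.
lemma mulVec_eq_self {x : ι → ℂ} (hx : (V + Vᴴ) *ᵥ x = (2 : ℂ) • x) : V *ᵥ x = x := by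
  have h : ((V - 1)ᴴ * (V - 1)) *ᵥ x = 0 := by
    have : (V - 1)ᴴ * (V - 1) = (2 : ℂ) • 1 - (V + Vᴴ) := by
      rw [Matrix.conjTranspose_sub, Matrix.conjTranspose_one, sub_mul, mul_sub, mul_sub, hV',
        two_smul]
      simp only [one_mul, mul_one]
      abel
    rw [this, Matrix.sub_mulVec, hx, Matrix.smul_mulVec, Matrix.one_mulVec, sub_self]
  rw [Matrix.conjTranspose_mul_self_mulVec_eq_zero, Matrix.sub_mulVec, Matrix.one_mulVec,
    sub_eq_zero] at h
  exact h

omit hV hV' in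
/-- The bound for a combination of joint eigenvectors. -/
lemma normSq_mulVec_sum_le {κ : Type*} [Fintype κ] {Z : Matrix ι ι ℂ} {e : κ → ι → ℂ}
    (he : ∀ i j, i ≠ j → star (e i) ⬝ᵥ e j = 0) {g : κ → ℝ}
    (hZ : ∀ i, Zᴴ *ᵥ (Z *ᵥ e i) = ((g i : ℝ) : ℂ) • e i) {b : ℝ} (a : κ → ℂ)
    (hg : ∀ i, a i ≠ 0 → g i ≤ b) :
    normSq (Z *ᵥ ∑ i, a i • e i) ≤ b * normSq (∑ i, a i • e i) := by
  have hsq : ∀ w : ι → ℂ, ((normSq w : ℝ) : ℂ) = star w ⬝ᵥ w := fun w => by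
    simp only [normSq, dotProduct, Pi.star_apply, RCLike.star_def, RCLike.conj_mul]
    push_cast; rfl
  have hpair : ∀ γ : κ → ℂ, star (∑ i, a i • e i) ⬝ᵥ (∑ i, (γ i * a i) • e i) =
      ∑ i, γ i * ((‖a i‖ ^ 2 * normSq (e i) : ℝ) : ℂ) := fun γ => by
    rw [star_sum, sum_dotProduct]
    refine Finset.sum_congr rfl fun i _ => ?_
    rw [dotProduct_sum, Finset.sum_eq_single i]
    · rw [star_smul, smul_dotProduct, dotProduct_smul, ← hsq]
      simp only [smul_eq_mul, RCLike.star_def]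
      have := RCLike.conj_mul (a i)
      push_cast
      linear_combination γ i * ((normSq (e i) : ℝ) : ℂ) * this
    · intro j _ hj
      rw [star_smul, smul_dotProduct, dotProduct_smul, he i j hj.symm]; simp
    · simp
  have h1 : ((normSq (Z *ᵥ ∑ i, a i • e i) : ℝ) : ℂ) =
      ((∑ i, g i * (‖a i‖ ^ 2 * normSq (e i)) : ℝ) : ℂ) := by
    rw [hsq, Matrix.star_mulVec, ← Matrix.dotProduct_mulVec]
    have : Zᴴ *ᵥ (Z *ᵥ ∑ i, a i • e i) = ∑ i, (((g i : ℝ) : ℂ) * a i) • e i := by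
      rw [Matrix.mulVec_sum, Matrix.mulVec_sum]
      refine Finset.sum_congr rfl fun i _ => ?_
      rw [Matrix.mulVec_smul, Matrix.mulVec_smul, hZ, smul_smul, mul_comm]
    rw [this, hpair]
    push_cast; rfl
  have h2 : ((normSq (∑ i, a i • e i) : ℝ) : ℂ) =
      ((∑ i, ‖a i‖ ^ 2 * normSq (e i) : ℝ) : ℂ) := by
    have := hpair fun _ => 1
    simp only [one_mul] at this
    rw [hsq, this]
    push_cast; rfl
  rw [Complex.ofReal_inj.1 h1, Complex.ofReal_inj.1 h2, Finset.mul_sum]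
  refine Finset.sum_le_sum fun i _ => ?_
  by_cases hi : a i = 0
  · simp [hi]
  · exact mul_le_mul_of_nonneg_right (hg i hi)
      (mul_nonneg (sq_nonneg _) (normSq_nonneg _))

end Average

/-! ## The walk operator -/

section Walk

variable {X D : Type*} [Fintype X] [DecidableEq X] {d : X → D} {z : X}
  {P : Matrix X X ℝ} {p : X → ℝ} (W : WalkUpdates d z P p)

/-- The discriminant of a reversible chain. -/
def discriminant (P : Matrix X X ℝ) : Matrix X X ℝ :=
  Matrix.of fun x y => √(P x y) * √(P y x)

/-- The states with blank right register. -/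
def embedRight (d : X → D) (z : X) (f : X → ℂ) : DataState d × DataState d → ℂ := fun q =>
  if q.2 = withData d z then f q.1.point else 0

/-- The states with blank left register. -/
def embedLeft (d : X → D) (z : X) (f : X → ℂ) : DataState d × DataState d → ℂ := fun q =>
  if q.1 = withData d z then f q.2.point else 0

lemma withData_point (q : DataState d) : withData d q.point = q := (dataEquiv d).right_inv q

lemma sum_dataState {V : Type*} [AddCommMonoid V] (f : DataState d → V) :
    ∑ q, f q = ∑ x, f (withData d x) :=
  ((dataEquiv d).sum_comp f).symm

lemma right_apply (q : DataState d × DataState d) (x : X) :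
    W.right.1 q (withData d x, withData d z) =
      if q.1 = withData d x then ((√(P x q.2.point) : ℝ) : ℂ) else 0 := by
  have := congrFun (W.right_blank x) q
  rwa [Matrix.mulVec_single_one] at this

lemma left_apply (q : DataState d × DataState d) (y : X) :
    W.left.1 q (withData d z, withData d y) =
      if q.2 = withData d y then ((√(timeReversal P p y q.1.point) : ℝ) : ℂ) else 0 := by
  have := congrFun (W.left_blank y) q
  rwa [Matrix.mulVec_single_one] at this

lemma right_mulVec_embedRight (f : X → ℂ) (q : DataState d × DataState d) :
    (W.right.1 *ᵥ embedRight d z f) q =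
      f q.1.point * ((√(P q.1.point q.2.point) : ℝ) : ℂ) := by
  simp only [Matrix.mulVec, dotProduct, Fintype.sum_prod_type, embedRight, mul_ite, mul_zero,
    Finset.sum_ite_eq', Finset.mem_univ, if_true]
  rw [sum_dataState, Fintype.sum_eq_single q.1.point]
  · rw [right_apply, if_pos (withData_point _).symm, mul_comm]; rfl
  · intro x hx
    rw [right_apply, if_neg, zero_mul]
    rintro h
    exact hx (congrArg DataState.point h).symm

lemma left_mulVec_embedLeft (f : X → ℂ) (q : DataState d × DataState d) :
    (W.left.1 *ᵥ embedLeft d z f) q =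
      f q.2.point * ((√(timeReversal P p q.2.point q.1.point) : ℝ) : ℂ) := by
  simp only [Matrix.mulVec, dotProduct, Fintype.sum_prod_type, embedLeft]
  rw [Fintype.sum_eq_single (withData d z)]
  · rw [sum_dataState, Fintype.sum_eq_single q.2.point]
    · rw [left_apply, if_pos (withData_point _).symm, if_pos rfl, mul_comm]; rfl
    · intro x hx
      rw [left_apply, if_neg, zero_mul]
      rintro h
      exact hx (congrArg DataState.point h).symm
  · intro y hy
    simp [hy]

/-- The operator that compares the two updates. -/
def crossing : Matrix (DataState d × DataState d) (DataState d × DataState d) ℂ :=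
  W.left.1ᴴ * W.right.1

/-- The entries of the discriminant are the inner products of the states `|x⟩ ∑ √p_xy |y⟩` and `∑
√p*_yx |x⟩|y⟩`, which overlap only in `|x⟩|y⟩`; reversibility replaces `p*` by `p`. -/
lemma crossing_mulVec_embedRight (hrev : timeReversal P p = P) (f : X → ℂ) (y : DataState d) :
    (crossing W *ᵥ embedRight d z f) (withData d z, y) =
      ((discriminant P).map Complex.ofReal *ᵥ f) y.point := by
  rw [crossing, ← Matrix.mulVec_mulVec]
  conv_lhs => rw [← withData_point y]
  simp only [Matrix.mulVec, dotProduct, Matrix.conjTranspose_apply, left_apply, hrev]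
  rw [Fintype.sum_prod_type, sum_dataState]
  refine Finset.sum_congr rfl fun x _ => ?_
  rw [Fintype.sum_eq_single y]
  · have h := right_mulVec_embedRight W f (withData d x, y)
    simp only [Matrix.mulVec, dotProduct] at h
    rw [h, if_pos (withData_point y).symm, RCLike.star_def, Complex.conj_ofReal]
    simp only [discriminant, Matrix.map_apply, Matrix.of_apply]
    push_cast
    change _ * (f x * _) = _
    rw [← mul_assoc, mul_right_comm]; rfl
  · intro y' hy'
    rw [if_neg (by rwa [withData_point])]
    simp

lemma crossing_conjTranspose_mulVec_embedLeft (hrev : timeReversal P p = P) (f : X → ℂ)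
    (x : DataState d) :
    ((crossing W)ᴴ *ᵥ embedLeft d z f) (x, withData d z) =
      ((discriminant P).map Complex.ofReal *ᵥ f) x.point := by
  rw [crossing, Matrix.conjTranspose_mul, Matrix.conjTranspose_conjTranspose,
    ← Matrix.mulVec_mulVec]
  conv_lhs => rw [← withData_point x]
  simp only [Matrix.mulVec, dotProduct, Matrix.conjTranspose_apply, right_apply]
  rw [Fintype.sum_prod_type_right, sum_dataState]
  refine Finset.sum_congr rfl fun y _ => ?_
  rw [Fintype.sum_eq_single x]
  · have h := left_mulVec_embedLeft W f (x, withData d y)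
    simp only [Matrix.mulVec, dotProduct, hrev] at h
    rw [h, if_pos (withData_point x).symm, RCLike.star_def, Complex.conj_ofReal]
    simp only [discriminant, Matrix.map_apply, Matrix.of_apply]
    push_cast
    change _ * (f y * _) = _
    rw [← mul_assoc, mul_right_comm]; rfl
  · intro x' hx'
    rw [if_neg (by rwa [withData_point])]
    simp

/-- The quantum walk, in the picture where the right register is blank before the update. -/
def walkMatrix : Matrix (DataState d × DataState d) (DataState d × DataState d) ℂ :=
  reflRight d z * ((crossing W)ᴴ * (reflLeft d z * crossing W))

lemma crossing_conjTranspose_mul : (crossing W)ᴴ * crossing W = 1 := by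
  rw [crossing, Matrix.conjTranspose_mul, Matrix.conjTranspose_conjTranspose, mul_assoc,
    ← mul_assoc W.left.1, ← Matrix.star_eq_conjTranspose W.left.1,
    (Unitary.mem_iff.1 W.left.2).2, one_mul]
  exact (Unitary.mem_iff.1 W.right.2).1

lemma crossing_mul_conjTranspose : crossing W * (crossing W)ᴴ = 1 :=
  mul_eq_one_comm.1 (crossing_conjTranspose_mul W)

lemma diagonal_sign_conjTranspose {ι : Type*} [Fintype ι] [DecidableEq ι] (c : ι → Prop)
    [DecidablePred c] : (Matrix.diagonal fun b => if c b then (-1 : ℂ) else 1)ᴴ =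
      Matrix.diagonal fun b => if c b then (-1 : ℂ) else 1 := by
  rw [Matrix.diagonal_conjTranspose]
  congr 1
  funext b
  by_cases h : c b <;> simp [h]

lemma diagonal_sign_mul_self {ι : Type*} [Fintype ι] [DecidableEq ι] (c : ι → Prop)
    [DecidablePred c] : (Matrix.diagonal fun b => if c b then (-1 : ℂ) else 1) *
      (Matrix.diagonal fun b => if c b then (-1 : ℂ) else 1) = 1 := by
  have h := (Unitary.mem_iff.1 (diagonal_sign_mem_unitaryGroup c)).1
  rwa [Matrix.star_eq_conjTranspose, diagonal_sign_conjTranspose] at h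

lemma reflLeft_mul_self : reflLeft d z * reflLeft d z = 1 := diagonal_sign_mul_self _

lemma reflRight_mul_self : reflRight d z * reflRight d z = 1 := diagonal_sign_mul_self _

lemma walkMatrix_conjTranspose :
    (walkMatrix W)ᴴ = (crossing W)ᴴ * (reflLeft d z * crossing W) * reflRight d z := by
  have hL : (reflLeft d z)ᴴ = reflLeft d z := diagonal_sign_conjTranspose _
  have hR : (reflRight d z)ᴴ = reflRight d z := diagonal_sign_conjTranspose _
  rw [walkMatrix, Matrix.conjTranspose_mul, Matrix.conjTranspose_mul, Matrix.conjTranspose_mul,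
    Matrix.conjTranspose_conjTranspose, hL, hR, ← mul_assoc (crossing W)ᴴ]

lemma walkMatrix_mul_conjTranspose : walkMatrix W * (walkMatrix W)ᴴ = 1 := by
  rw [walkMatrix_conjTranspose, walkMatrix]
  calc _ = reflRight d z * ((crossing W)ᴴ * (reflLeft d z * (crossing W * (crossing W)ᴴ) *
        reflLeft d z) * crossing W) * reflRight d z := by simp only [mul_assoc]
    _ = 1 := by
      rw [crossing_mul_conjTranspose, mul_one, reflLeft_mul_self, mul_one,
        crossing_conjTranspose_mul, mul_one, reflRight_mul_self]

lemma walkMatrix_conjTranspose_mul : (walkMatrix W)ᴴ * walkMatrix W = 1 :=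
  mul_eq_one_comm.1 (walkMatrix_mul_conjTranspose W)

/-- On the states with blank right register, the real part of the walk is a polynomial in the
discriminant. -/
lemma walkMatrix_add_mulVec (hrev : timeReversal P p = P) {f : X → ℂ} {l : ℝ}
    (hf : (discriminant P).map Complex.ofReal *ᵥ f = ((l : ℝ) : ℂ) • f) :
    (walkMatrix W + (walkMatrix W)ᴴ) *ᵥ embedRight d z f =
      ((2 * (2 * l ^ 2 - 1) : ℝ) : ℂ) • embedRight d z f := by
  have hR : reflRight d z *ᵥ embedRight d z f = embedRight d z f := by
    funext q
    simp only [reflRight, Matrix.mulVec_diagonal, embedRight]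
    split_ifs <;> simp_all
  -- Jordan's picture of two reflections: the right-blank copy of `f` and the pulled-back left-blank
  -- copy meet at an angle with cosine `l`. The walk rotates by twice that angle, whose cosine is
  -- `2l² - 1`.
  have hL : reflLeft d z *ᵥ (crossing W *ᵥ embedRight d z f) =
      ((2 * l : ℝ) : ℂ) • embedLeft d z f - crossing W *ᵥ embedRight d z f := by
    funext q
    obtain ⟨q₁, q₂⟩ := q
    simp only [reflLeft, Matrix.mulVec_diagonal, embedLeft, Pi.sub_apply, Pi.smul_apply]
    by_cases h : q₁ = withData d z
    · subst h
      rw [crossing_mulVec_embedRight W hrev, hf]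
      simp; ring
    · simp [h]
  have hS : ((crossing W)ᴴ * (reflLeft d z * crossing W)) *ᵥ embedRight d z f =
      ((2 * l : ℝ) : ℂ) • ((crossing W)ᴴ *ᵥ embedLeft d z f) - embedRight d z f := by
    rw [← Matrix.mulVec_mulVec, ← Matrix.mulVec_mulVec, hL, Matrix.mulVec_sub,
      Matrix.mulVec_smul, Matrix.mulVec_mulVec, crossing_conjTranspose_mul, Matrix.one_mulVec]
  rw [walkMatrix_conjTranspose, walkMatrix, Matrix.add_mulVec,
    ← Matrix.mulVec_mulVec _ (reflRight d z), ← Matrix.mulVec_mulVec _ _ (reflRight d z), hR, hS]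
  funext q
  obtain ⟨q₁, q₂⟩ := q
  simp only [Pi.add_apply, Pi.smul_apply, reflRight, Matrix.mulVec_diagonal, Pi.sub_apply]
  by_cases h : q₂ = withData d z
  · subst h
    rw [crossing_conjTranspose_mulVec_embedLeft W hrev, hf]
    simp [embedRight]; ring
  · simp [h, embedRight]

end Walk

end

noncomputable section

/-! ## The spectrum of a reversible chain -/

section Chain

variable {X : Type*} [Fintype X] [DecidableEq X] {P : Matrix X X ℝ} {p : X → ℝ}

lemma eigenvalueGap_le_one (P : Matrix X X ℝ) : eigenvalueGap P ≤ 1 := by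
  have : 0 ≤ sSup {r : ℝ | ∃ l ∈ spectrum ℂ (P.map (Complex.ofReal)), l ≠ 1 ∧ r = ‖l‖} :=
    Real.sSup_nonneg fun r ⟨l, _, _, hr⟩ => hr ▸ norm_nonneg l
  unfold eigenvalueGap
  linarith

lemma norm_le_of_mem_spectrum {l : ℂ} (hl : l ∈ spectrum ℂ (P.map (Complex.ofReal)))
    (h1 : l ≠ 1) : ‖l‖ ≤ 1 - eigenvalueGap P := by
  unfold eigenvalueGap
  rw [sub_sub_cancel]
  refine le_csSup ?_ ⟨l, hl, h1, rfl⟩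
  -- Finiteness of the spectrum supplies the boundedness without which `sSup` would take its default
  -- value.
  refine Set.Finite.bddAbove (((P.map (Complex.ofReal)).finite_spectrum.image norm).subset ?_)
  rintro r ⟨l, hl, -, rfl⟩
  exact ⟨l, hl, rfl⟩

lemma mem_spectrum_of_mulVec {A : Matrix X X ℂ} {l : ℂ} {h : X → ℂ} (hA : A *ᵥ h = l • h)
    (h0 : h ≠ 0) : l ∈ spectrum ℂ A := by
  rw [spectrum.mem_iff]
  rintro ⟨u, hu⟩
  apply h0
  have h1 : (u : Matrix X X ℂ) *ᵥ h = 0 := by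
    rw [hu, Matrix.sub_mulVec, hA, Algebra.algebraMap_eq_smul_one, Matrix.smul_mulVec,
      Matrix.one_mulVec, sub_self]
  calc h = ((u⁻¹ : (Matrix X X ℂ)ˣ) : Matrix X X ℂ) *ᵥ ((u : Matrix X X ℂ) *ᵥ h) := by
        rw [Matrix.mulVec_mulVec, Units.inv_mul, Matrix.one_mulVec]
    _ = 0 := by rw [h1, Matrix.mulVec_zero]

lemma IsErgodicChain.exists_pow_pos (hP : IsErgodicChain P) (x y : X) :
    ∃ k : ℕ, 0 < (P ^ k) x y :=
  let ⟨k, _, hk⟩ := (Matrix.isIrreducible_iff_exists_pow_pos hP.irreducible.nonneg).1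
    hP.irreducible x y
  ⟨k, hk⟩

/-- Some state has positive mass, and irreducibility carries it to `x` along a power of `P`. -/
lemma IsStationary.pos (hp : IsStationary P p) (hP : IsErgodicChain P) (x : X) : 0 < p x := by
  have hpow : ∀ k : ℕ, p ᵥ* (P ^ k) = p := fun k => by
    induction k with
    | zero => simp
    | succ k ih => rw [pow_succ, ← Matrix.vecMul_vecMul, ih, hp.2]
  obtain ⟨y, hy⟩ : ∃ y, 0 < p y := by
    by_contra! hcon
    have : ∑ y, p y ≤ 0 := Finset.sum_nonpos fun y _ => hcon y
    rw [hp.1.2] at this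
    linarith
  obtain ⟨k, hk⟩ := hP.exists_pow_pos y x
  have hPk := pow_mem hP.stochastic k
  rw [← hpow k]
  exact (mul_pos hy hk).trans_le (Finset.single_le_sum (f := fun w => p w * (P ^ k) w x)
    (fun w _ => mul_nonneg (hp.1.1 w) (Matrix.nonneg_of_mem_rowStochastic hPk))
    (Finset.mem_univ y))

/-- The maximum principle: a real function that is harmonic for an ergodic chain is constant. -/
lemma IsErgodicChain.harmonic_const (hP : IsErgodicChain P) {h : X → ℝ} (hh : P *ᵥ h = h)
    (x y : X) : h x = h y := by
  have hpow : ∀ k : ℕ, (P ^ k) *ᵥ h = h := fun k => by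
    induction k with
    | zero => simp
    | succ k ih => rw [pow_succ, ← Matrix.mulVec_mulVec, hh, ih]
  obtain ⟨t, -, ht⟩ := Finset.exists_max_image Finset.univ h ⟨x, Finset.mem_univ x⟩
  suffices H : ∀ w, h w = h t by rw [H x, H y]
  intro w
  obtain ⟨k, hk⟩ := hP.exists_pow_pos t w
  have hPk := pow_mem hP.stochastic k
  -- The nonnegative deficits `h t - h v` average to zero, so the deficit vanishes wherever `t`
  -- leads in `k` steps with positive probability.
  have hsum : ∑ v, (P ^ k) t v * (h t - h v) = 0 := by
    have h1 : ∑ v, (P ^ k) t v * h v = h t := congrFun (hpow k) t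
    simp only [mul_sub, Finset.sum_sub_distrib, h1, ← Finset.sum_mul,
      Matrix.sum_row_of_mem_rowStochastic hPk, one_mul, sub_self]
  have hz := (Finset.sum_eq_zero_iff_of_nonneg fun v _ =>
    mul_nonneg (Matrix.nonneg_of_mem_rowStochastic hPk)
      (sub_nonneg.2 (ht v (Finset.mem_univ v)))).1 hsum w (Finset.mem_univ w)
  rcases mul_eq_zero.1 hz with h0 | h0 <;> linarith

variable (hP : IsErgodicChain P) (hp : IsStationary P p) (hrev : IsReversibleChain P p)

include hP hp hrev

lemma detailed_balance (x y : X) : p x * P x y = p y * P y x := by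
  have h := congrFun (congrFun hrev y) x
  rw [timeReversal, Matrix.of_apply, eq_div_iff (hp.pos hP y).ne'] at h
  linarith

/-- Detailed balance gives `D = diag(√p) P diag(√p)⁻¹`: the symmetric discriminant is similar to
`P`. -/
lemma discriminant_mul_sqrt (x y : X) : discriminant P x y * √(p y) = √(p x) * P x y := by
  have h0 : ∀ x y, 0 ≤ P x y := hP.irreducible.nonneg
  rw [discriminant, Matrix.of_apply, mul_assoc, ← Real.sqrt_mul (h0 y x), mul_comm (P y x),
    ← detailed_balance hP hp hrev, Real.sqrt_mul (hp.1.1 x), mul_left_comm,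
    Real.mul_self_sqrt (h0 x y)]

lemma discriminant_mulVec_sqrt :
    (discriminant P).map Complex.ofReal *ᵥ (fun x => ((√(p x) : ℝ) : ℂ)) =
      fun x => ((√(p x) : ℝ) : ℂ) := by
  funext x
  simp only [Matrix.mulVec, dotProduct, Matrix.map_apply, ← Complex.ofReal_mul,
    discriminant_mul_sqrt hP hp hrev, ← Complex.ofReal_sum, ← Finset.mul_sum,
    Matrix.sum_row_of_mem_rowStochastic hP.stochastic, mul_one]

/-- An eigenvalue of the discriminant is separated from one, unless the eigenvector is
proportional to the square root of the stationary distribution. -/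
lemma discriminant_eigenvalue {f : X → ℂ} {l : ℝ} (hf0 : f ≠ 0)
    (hf : (discriminant P).map Complex.ofReal *ᵥ f = (l : ℂ) • f) :
    |l| ≤ 1 - eigenvalueGap P ∨ ∃ c : ℂ, f = c • fun x => ((√(p x) : ℝ) : ℂ) := by
  have hs : ∀ x, ((√(p x) : ℝ) : ℂ) ≠ 0 := fun x =>
    Complex.ofReal_ne_zero.2 (Real.sqrt_pos.2 (hp.pos hP x)).ne'
  -- Dividing by `√p` turns an eigenvector of the discriminant into one of `P`.
  set h : X → ℂ := fun x => f x / ((√(p x) : ℝ) : ℂ) with hdef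
  have hfh : ∀ x, f x = h x * ((√(p x) : ℝ) : ℂ) := fun x => (div_mul_cancel₀ _ (hs x)).symm
  have hPh : P.map Complex.ofReal *ᵥ h = (l : ℂ) • h := by
    funext x
    have hx := congrFun hf x
    simp only [Matrix.mulVec, dotProduct, Matrix.map_apply, Pi.smul_apply, smul_eq_mul] at hx ⊢
    have h1 : ∀ y, ((discriminant P x y : ℝ) : ℂ) * f y =
        ((√(p x) : ℝ) : ℂ) * (((P x y : ℝ) : ℂ) * h y) := fun y => by
      have := congrArg Complex.ofReal (discriminant_mul_sqrt hP hp hrev x y)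
      push_cast at this
      rw [hfh]
      linear_combination h y * this
    rw [Finset.sum_congr rfl fun y _ => h1 y, ← Finset.mul_sum, hfh x] at hx
    refine mul_left_cancel₀ (hs x) ?_
    rw [hx]; ring
  have hh0 : h ≠ 0 := fun h0 => hf0 (by
    funext x
    rw [hfh, h0, Pi.zero_apply, zero_mul])
  -- For eigenvalue one the real and imaginary parts of `h` are harmonic, so `h` is constant; any
  -- other eigenvalue is controlled by the gap.
  by_cases hl : l = 1
  · right
    subst hl
    obtain ⟨x₀⟩ : Nonempty X := by
      by_contra hcon
      exact hf0 (funext fun x => (hcon ⟨x⟩).elim)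
    refine ⟨h x₀, funext fun x => ?_⟩
    have hre : P *ᵥ (fun x => (h x).re) = fun x => (h x).re := by
      funext x
      have := congrArg Complex.re (congrFun hPh x)
      simpa [Matrix.mulVec, dotProduct] using this
    have him : P *ᵥ (fun x => (h x).im) = fun x => (h x).im := by
      funext x
      have := congrArg Complex.im (congrFun hPh x)
      simpa [Matrix.mulVec, dotProduct] using this
    have : h x = h x₀ :=
      Complex.ext (hP.harmonic_const hre x x₀) (hP.harmonic_const him x x₀)
    rw [hfh, this]; rfl
  · left
    have := norm_le_of_mem_spectrum (mem_spectrum_of_mulVec hPh hh0)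
      (fun hc => hl (by exact_mod_cast hc))
    rwa [Complex.norm_real] at this

end Chain

/-! ### Spectral bounds for the walk on states with blank right register. -/

section Walk

variable {X D : Type*} [Fintype X] [DecidableEq X] {d : X → D} {z : X}
  {P : Matrix X X ℝ} {p : X → ℝ} (W : WalkUpdates d z P p)

lemma embedRight_sum {κ : Type*} (s : Finset κ) (a : κ → ℂ) (f : κ → X → ℂ) :
    embedRight d z (∑ i ∈ s, a i • f i) = ∑ i ∈ s, a i • embedRight d z (f i) := by
  funext q
  simp only [embedRight, Finset.sum_apply, Pi.smul_apply, smul_eq_mul]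
  split_ifs <;> simp

lemma star_embedRight_dotProduct (f g : X → ℂ) :
    star (embedRight d z f) ⬝ᵥ embedRight d z g = star f ⬝ᵥ g := by
  simp only [dotProduct, Fintype.sum_prod_type, Pi.star_apply, embedRight]
  rw [sum_dataState]
  refine Finset.sum_congr rfl fun x _ => ?_
  rw [Fintype.sum_eq_single (withData d z)]
  · simp only [if_true]; rfl
  · intro y hy
    simp [hy]

variable (hP : IsErgodicChain P) (hp : IsStationary P p) (hrev : IsReversibleChain P p)

include hP hp hrev

lemma walkMatrix_mulVec_sqrt :
    walkMatrix W *ᵥ embedRight d z (fun x => ((√(p x) : ℝ) : ℂ)) =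
      embedRight d z fun x => ((√(p x) : ℝ) : ℂ) := by
  refine mulVec_eq_self (walkMatrix_mul_conjTranspose W) (walkMatrix_conjTranspose_mul W) ?_
  have h := walkMatrix_add_mulVec W hrev.symm (l := 1)
    (f := fun x => ((√(p x) : ℝ) : ℂ))
    (by rw [discriminant_mulVec_sqrt hP hp hrev, Complex.ofReal_one, one_smul])
  rw [h]
  congr 1
  norm_num

/-- The products of averages of powers of the walk almost annihilate the states with blank right
register that are orthogonal to the stationary state. -/
lemma normSq_averageProduct_le {n : ℕ} (hgap : 0 < eigenvalueGap P)
    (hn : 4 ≤ 4 ^ n * eigenvalueGap P) (s : ℕ) {u : X → ℂ}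
    (hu : ∑ x, ((√(p x) : ℝ) : ℂ) * u x = 0) :
    normSq (averageProduct (walkMatrix W) (exponents n s) *ᵥ embedRight d z u) ≤
      ((1 / 2) ^ s) ^ 2 * normSq (embedRight d z u) := by
  have hD : ((discriminant P).map Complex.ofReal).IsHermitian := by
    ext x y
    simp only [Matrix.conjTranspose_apply, Matrix.map_apply, discriminant, Matrix.of_apply,
      RCLike.star_def, Complex.conj_ofReal, mul_comm]
  -- An eigenbasis of the discriminant embeds to orthogonal vectors on which the averages have
  -- explicit norms. Since `u` is orthogonal to `√p`, basis vectors proportional to `√p` have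
  -- coefficient zero.
  set b := hD.eigenvectorBasis
  set a : X → ℂ := fun i => inner ℂ (b i) (WithLp.toLp 2 u) with ha
  have hu_sum : u = ∑ i, a i • (b i).ofLp := by
    have h := b.sum_repr' (WithLp.toLp 2 u)
    have h2 := congrArg WithLp.ofLp h
    rw [WithLp.ofLp_sum] at h2
    exact h2.symm
  have heig : ∀ i, (discriminant P).map Complex.ofReal *ᵥ (b i).ofLp =
      ((hD.eigenvalues i : ℝ) : ℂ) • (b i).ofLp := fun i => by
    rw [hD.mulVec_eigenvectorBasis, RCLike.real_smul_eq_coe_smul (K := ℂ)]; rfl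
  rw [hu_sum, embedRight_sum]
  refine normSq_mulVec_sum_le (g := fun i => ((exponents n s).map fun j =>
    (1 + doubling (2 * hD.eigenvalues i ^ 2 - 1) j) / 2).prod) ?_ ?_ a ?_
  · intro i j hij
    rw [star_embedRight_dotProduct]
    have : inner ℂ (b i) (b j) = 0 := b.orthonormal.2 hij
    rwa [EuclideanSpace.inner_eq_star_dotProduct, dotProduct_comm] at this
  · intro i
    exact averageProduct_mulVec (walkMatrix_mul_conjTranspose W)
      (walkMatrix_conjTranspose_mul W) (walkMatrix_add_mulVec W hrev.symm (heig i)) _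
  · intro i hi
    have hb0 : (b i).ofLp ≠ 0 := fun h0 => b.orthonormal.ne_zero i (by
      ext x; exact congrFun h0 x)
    rcases discriminant_eigenvalue hP hp hrev hb0 (heig i) with hl | ⟨c, hc⟩
    · refine prod_exponents_le (δ := eigenvalueGap P) ?_ hn s
      -- With gap `δ ≤ 1`, `1 - l² ≥ 1 - (1 - δ)² = 2δ - δ² ≥ δ`.
      have h1 := eigenvalueGap_le_one P
      nlinarith [abs_nonneg (hD.eigenvalues i), sq_abs (hD.eigenvalues i)]
    · exfalso
      apply hi
      simp only [ha]
      rw [EuclideanSpace.inner_eq_star_dotProduct, hc, dotProduct_comm, star_smul,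
        smul_dotProduct]
      have : star (fun x => ((√(p x) : ℝ) : ℂ)) ⬝ᵥ u = 0 := by
        rw [← hu]
        simp only [dotProduct, Pi.star_apply, RCLike.star_def, Complex.conj_ofReal]
      rw [this, smul_zero]

end Walk

end

noncomputable section

/-! ## The circuits -/

section Circuits

variable {m : ℕ}

/-- One step of the walk, controlled by qubit `j`. -/
def walkStep (j : Fin m) : List (Gate m) :=
  [.updateRight, .updateLeftInv, .reflectLeft fun a => a j, .updateLeft, .updateRightInv,
    .reflectRight fun a => a j]

/-- A power of the walk, controlled by qubit `j`. -/
def walkPow (j : Fin m) (w : ℕ) : List (Gate m) := (List.replicate w (walkStep j)).flatten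

/-- The interference circuit of a controlled operation. -/
def gadget (j : Fin m) (L : List (Gate m)) : List (Gate m) :=
  hadamardGate j :: (L ++ [hadamardGate j])

/-- The qubit with a given number. -/
def qubit (N q : ℕ) : Fin (N + 1) := Fin.ofNat (N + 1) q

lemma qubit_val {N q : ℕ} (h : q ≤ N) : (qubit N q : ℕ) = q :=
  Nat.mod_eq_of_lt (Nat.lt_succ_of_le h)

/-- Interference circuits of powers of the walk, on consecutive qubits. -/
def walkGadgets (N : ℕ) : List ℕ → ℕ → List (Gate (N + 1))
  | [], _ => []
  | j :: js, q => gadget (qubit N q) (walkPow (qubit N q) (2 ^ j)) ++ walkGadgets N js (q + 1)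

/-- The first qubit of a level of the recursion. -/
def levelOffset (n : ℕ) : ℕ → ℕ
  | 0 => 0
  -- Every level has its own qubits: one for the projection on the blank right register, and `n` for
  -- each of the `k + 5` blocks of averages.
  | k + 1 => levelOffset n k + 1 + (k + 5) * n

/-- The circuit whose blank outcome is the approximate projection on the stationary state. -/
def approxGates (N n k : ℕ) : List (Gate (N + 1)) :=
  gadget (qubit N (levelOffset n k)) [.reflectRight fun a => a (qubit N (levelOffset n k))] ++
    walkGadgets N (exponents n (k + 5)) (levelOffset n k + 1)

/-- The recursive amplitude amplification with approximate reflections. -/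
def amplifyGates (N n : ℕ) : ℕ → List (Gate (N + 1))
  | 0 => []
  -- In order of application: `A`, the marked phase flip, `A⁻¹`, the approximate reflection `V⁻¹(2Π
  -- - 1)V`, and `A` again.
  | k + 1 => amplifyGates N n k ++ ([.check] ++ (invList (amplifyGates N n k) ++
      (approxGates N n k ++ ([blankGate (N + 1)] ++ (invList (approxGates N n k) ++
        amplifyGates N n k)))))

lemma levelOffset_mono (n : ℕ) : Monotone (levelOffset n) :=
  monotone_nat_of_le_succ fun k => by rw [levelOffset]; omega

end Circuits

section Semantics

variable {X D : Type*} [Fintype X] [DecidableEq X] {d : X → D} {z : X}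
  {P : Matrix X X ℝ} {p : X → ℝ} {m : ℕ} (W : WalkUpdates d z P p) (M : Finset X)

/-- A list of gates acts on the registers by a matrix, controlled by qubit `j`. -/
def IsControlled (j : Fin m) (L : List (Gate m))
    (V : Matrix (DataState d × DataState d) (DataState d × DataState d) ℂ) : Prop :=
  ∀ (v : StateSpace d m) (a : Qubits m), slice (actList W M L v) a =
    if a j = true then V *ᵥ slice v a else slice v a

lemma isControlled_reflectRight (j : Fin m) :
    IsControlled W M j [.reflectRight fun a => a j] (reflRight d z) := fun v a => by
  rw [actList_cons, actList_nil, slice_reflectRight]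

/-- Controlling the two reflections is enough: when the control is off, the updates cancel against
their inverses. -/
lemma isControlled_walkStep (j : Fin m) : IsControlled W M j (walkStep j) (walkMatrix W) := by
  intro v a
  have h1 : ∀ v : StateSpace d m, slice (Gate.updateRight.act W M v) a = W.right.1 *ᵥ slice v a :=
    fun v => slice_kronecker_one _ v a
  have h2 : ∀ v : StateSpace d m,
      slice (Gate.updateRightInv.act W M v) a = W.right.1ᴴ *ᵥ slice v a :=
    fun v => slice_kronecker_one _ v a
  have h3 : ∀ v : StateSpace d m, slice (Gate.updateLeft.act W M v) a = W.left.1 *ᵥ slice v a :=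
    fun v => slice_kronecker_one _ v a
  have h4 : ∀ v : StateSpace d m,
      slice (Gate.updateLeftInv.act W M v) a = W.left.1ᴴ *ᵥ slice v a :=
    fun v => slice_kronecker_one _ v a
  simp only [walkStep, actList_cons, actList_nil, slice_reflectRight, slice_reflectLeft, h1, h2,
    h3, h4]
  by_cases ha : a j = true
  · simp only [ha, if_true, Matrix.mulVec_mulVec, walkMatrix, crossing,
      Matrix.conjTranspose_mul, Matrix.conjTranspose_conjTranspose, mul_assoc]
  · simp only [ha]
    have hr := (Unitary.mem_iff.1 W.right.2).1
    have hl := (Unitary.mem_iff.1 W.left.2).2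
    rw [Matrix.star_eq_conjTranspose] at hr hl
    simp only [Bool.false_eq_true, if_false, Matrix.mulVec_mulVec]
    rw [← mul_assoc W.left.1, hl, one_mul, hr, Matrix.one_mulVec]

lemma isControlled_walkPow (j : Fin m) (w : ℕ) :
    IsControlled W M j (walkPow j w) (walkMatrix W ^ w) := by
  induction w with
  | zero => intro v a; simp [walkPow, actList_nil]
  | succ w ih =>
    intro v a
    rw [walkPow, List.replicate_succ, List.flatten_cons, actList_append_apply, ← walkPow, ih,
      isControlled_walkStep, pow_succ]
    by_cases ha : a j = true
    · simp only [ha, if_true, Matrix.mulVec_mulVec]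
    · simp [ha]

variable {W M}

/-- The Hadamard test: a control qubit that starts blank ends with branches `(1 + V)/2` and `(1 -
V)/2`. -/
lemma slice_gadget {j : Fin m} {L : List (Gate m)}
    {V : Matrix (DataState d × DataState d) (DataState d × DataState d) ℂ}
    (hL : IsControlled W M j L V) {v : StateSpace d m}
    (hv : ∀ a : Qubits m, a j = true → slice v a = 0) (a : Qubits m) :
    slice (actList W M (gadget j L) v) a = (1 / 2 : ℂ) •
      (slice v (Function.update a j false) +
        (if a j = true then (-1 : ℂ) else 1) • (V *ᵥ slice v (Function.update a j false))) := by
  have h1 : ∀ b, slice ((hadamardGate j).act W M v) b =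
      (((√2)⁻¹ : ℝ) : ℂ) • slice v (Function.update b j false) := fun b => by
    rw [slice_hadamardGate, hv (Function.update b j true) (Function.update_self ..), smul_zero,
      add_zero]
  have hr : (((√2)⁻¹ : ℝ) : ℂ) * (((√2)⁻¹ : ℝ) : ℂ) = 1 / 2 := by
    rw [← Complex.ofReal_mul, ← mul_inv, Real.mul_self_sqrt (by norm_num)]
    push_cast; norm_num
  rw [gadget, actList_cons, actList_append_apply, actList_cons, actList_nil, slice_hadamardGate,
    hL, hL, h1, h1]
  simp only [Function.update_self, Function.update_idem, Bool.false_eq_true, if_false, if_true,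
    Matrix.mulVec_smul]
  rw [smul_comm _ (((√2)⁻¹ : ℝ) : ℂ), ← smul_add, smul_smul, hr]

lemma gadget_mem_blankStabilizer {N : ℕ} {j : Fin m} (hj : (j : ℕ) < N) {L : List (Gate m)}
    {V : Matrix (DataState d × DataState d) (DataState d × DataState d) ℂ}
    (hL : IsControlled W M j L V) : actList W M (gadget j L) ∈ blankStabilizer d m N := by
  have h : actList W M (gadget j L) =
      (hadamardGate j).act W M * (actList W M L * (hadamardGate j).act W M) := by
    rw [gadget, actList, actList_append, actList, actList, one_mul, mul_assoc]
  rw [h]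
  refine mul_mem (hadamardGate_mem_blankStabilizer W M hj)
    (mul_mem ?_ (hadamardGate_mem_blankStabilizer W M hj))
  refine mem_blankStabilizer_of_slice fun v a hv => ?_
  rw [hL, hv]
  simp

lemma eq_zero_of_mem_blankFrom {j : Fin m} {v : StateSpace d m} (hv : v ∈ blankFrom d m j)
    (a : Qubits m) (ha : a j = true) : slice v a = 0 := hv a ⟨j, le_rfl, ha⟩

lemma gadget_apply_mem_blankFrom {j : Fin m} {L : List (Gate m)}
    {V : Matrix (DataState d × DataState d) (DataState d × DataState d) ℂ}
    (hL : IsControlled W M j L V) {v : StateSpace d m} (hv : v ∈ blankFrom d m j) :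
    actList W M (gadget j L) v ∈ blankFrom d m (j + 1) :=
  gadget_mem_blankStabilizer (Nat.lt_succ_self _) hL _ (blankFrom_mono (Nat.le_succ _) hv)

lemma slice_gadget_blank {j : Fin m} {L : List (Gate m)}
    {V : Matrix (DataState d × DataState d) (DataState d × DataState d) ℂ}
    (hL : IsControlled W M j L V) {v : StateSpace d m} (hv : v ∈ blankFrom d m j) :
    slice (actList W M (gadget j L) v) (fun _ => false) =
      ((1 / 2 : ℂ) • (1 + V)) *ᵥ slice v fun _ => false := by
  have hu : Function.update (fun _ => false : Qubits m) j false = fun _ => false :=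
    Function.update_eq_self j _
  rw [slice_gadget hL (eq_zero_of_mem_blankFrom hv), hu, Matrix.smul_mulVec, Matrix.add_mulVec,
    Matrix.one_mulVec]
  simp

/-- The states with blank ancilla qubits. -/
def withBlank (m : ℕ) (u : DataState d × DataState d → ℂ) : StateSpace d m :=
  WithLp.toLp 2 fun b => if b.2 = fun _ => false then u b.1 else 0

lemma slice_withBlank (u : DataState d × DataState d → ℂ) (a : Qubits m) :
    slice (withBlank m u) a = if a = fun _ => false then u else 0 := by
  funext q
  simp only [slice, withBlank]
  split_ifs <;> rfl

lemma withBlank_mem_blankFrom (u : DataState d × DataState d → ℂ) (N : ℕ) :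
    withBlank m u ∈ blankFrom d m N := by
  rintro a ⟨j, -, ha⟩
  rw [slice_withBlank, if_neg]
  rintro rfl
  cases ha

lemma gadget_withBlank {j : Fin m} {L : List (Gate m)}
    {V : Matrix (DataState d × DataState d) (DataState d × DataState d) ℂ}
    (hL : IsControlled W M j L V) {u : DataState d × DataState d → ℂ} (hu : V *ᵥ u = u) :
    actList W M (gadget j L) (withBlank m u) = withBlank m u := by
  refine ext_slice fun a => ?_
  rw [slice_gadget hL (eq_zero_of_mem_blankFrom (withBlank_mem_blankFrom u _)), slice_withBlank,
    slice_withBlank]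
  by_cases ha : a j = true
  · have hne : a ≠ fun _ => false := by rintro rfl; cases ha
    simp only [ha, if_true, hne, if_false]
    split_ifs
    · rw [hu]; module
    · simp
  · have hupd : Function.update a j false = a := by
      rw [← Bool.not_eq_true _ |>.mp ha, Function.update_eq_self]
    rw [hupd]
    simp only [ha, Bool.false_eq_true, if_false]
    split_ifs
    · rw [hu]; module
    · simp

variable (W M) in
lemma walkGadgets_mem_blankStabilizer {N N' : ℕ} (js : List ℕ) (q : ℕ)
    (hq : q + js.length ≤ N') (hN : N' ≤ N) :
    actList W M (walkGadgets N js q) ∈ blankStabilizer d (N + 1) N' := by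
  induction js generalizing q with
  | nil => exact one_mem _
  | cons j js ih =>
    rw [List.length_cons] at hq
    rw [walkGadgets, actList_append]
    exact mul_mem (ih _ (by omega)) (gadget_mem_blankStabilizer
      (by rw [qubit_val (by omega)]; omega) (isControlled_walkPow W M _ _))

variable (W M) in
lemma slice_walkGadgets {N : ℕ} (js : List ℕ) (q : ℕ) (hq : q + js.length ≤ N)
    {v : StateSpace d (N + 1)} (hv : v ∈ blankFrom d (N + 1) q) :
    slice (actList W M (walkGadgets N js q) v) (fun _ => false) =
      averageProduct (walkMatrix W) js *ᵥ slice v fun _ => false := by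
  induction js generalizing q v with
  | nil => rw [walkGadgets, actList_nil, averageProduct, Matrix.one_mulVec]
  | cons j js ih =>
    rw [List.length_cons] at hq
    have hval : (qubit N q : ℕ) = q := qubit_val (by omega)
    have hc := isControlled_walkPow W M (qubit N q) (2 ^ j)
    rw [walkGadgets, actList_append_apply, ih (q + 1) (by omega),
      slice_gadget_blank hc (by rwa [hval]), averageProduct, Matrix.mulVec_mulVec]
    have := gadget_apply_mem_blankFrom hc (v := v) (by rwa [hval])
    rwa [hval] at this

variable (W M) in
lemma walkGadgets_withBlank {N : ℕ} (js : List ℕ) (q : ℕ)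
    {u : DataState d × DataState d → ℂ} (hu : walkMatrix W *ᵥ u = u) :
    actList W M (walkGadgets N js q) (withBlank (N + 1) u) = withBlank (N + 1) u := by
  have hpow : ∀ w : ℕ, walkMatrix W ^ w *ᵥ u = u := fun w => by
    induction w with
    | zero => simp
    | succ w ih => rw [pow_succ, ← Matrix.mulVec_mulVec, hu, ih]
  induction js generalizing q with
  | nil => rfl
  | cons j js ih =>
    rw [walkGadgets, actList_append_apply,
      gadget_withBlank (isControlled_walkPow W M _ _) (hpow _), ih]

variable (W M) in
lemma approxGates_mem_blankStabilizer {N n k N' : ℕ} (hk : levelOffset n (k + 1) ≤ N')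
    (hN : N' ≤ N) : actList W M (approxGates N n k) ∈ blankStabilizer d (N + 1) N' := by
  rw [levelOffset] at hk
  rw [approxGates, actList_append]
  refine mul_mem (walkGadgets_mem_blankStabilizer W M _ _ ?_ hN) (gadget_mem_blankStabilizer ?_
    (isControlled_reflectRight W M _))
  · rw [length_exponents]; exact hk
  · rw [qubit_val (by omega)]; omega

variable (W M) in
-- The circuit of level `k` acts on the ancillas below `levelOffset n k` only, so the qubits of the
-- next approximate projection are still blank when it needs them.
lemma amplifyGates_mem_blankStabilizer {N n k N' : ℕ} (hk : levelOffset n k ≤ N')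
    (hN : N' ≤ N) : actList W M (amplifyGates N n k) ∈ blankStabilizer d (N + 1) N' := by
  induction k with
  | zero => exact one_mem _
  | succ k ih =>
    have hA := ih ((levelOffset_mono n (Nat.le_succ k)).trans hk)
    have hV := approxGates_mem_blankStabilizer W M hk hN
    have hone : ∀ g : Gate (N + 1), g.act W M ∈ blankStabilizer d (N + 1) N' →
        actList W M [g] ∈ blankStabilizer d (N + 1) N' := fun g hg => mul_mem (one_mem _) hg
    simp only [amplifyGates, actList_append, actList_invList]
    exact mul_mem (mul_mem (mul_mem (mul_mem (mul_mem (mul_mem hA (inv_mem hV))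
      (hone _ (blankGate_mem_blankStabilizer W M _))) hV) (inv_mem hA))
      (hone _ (check_mem_blankStabilizer W M _))) hA

/-! ### The stationary state -/

/-- The state constructed by the setup operation. -/
def startState (d : X → D) (z : X) (p : X → ℝ) (m : ℕ) : StateSpace d m :=
  WithLp.toLp 2 (setupState d z p m)

lemma startState_eq_withBlank :
    startState d z p m = withBlank m (embedRight d z fun x => ((√(p x) : ℝ) : ℂ)) := by
  ext ⟨q, a⟩
  simp only [startState, setupState, withBlank, embedRight]
  by_cases h1 : q.2 = withData d z <;> by_cases h2 : a = fun _ => false <;> simp [h1, h2]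

lemma norm_startState (hp : p ∈ stdSimplex ℝ X) : ‖startState d z p m‖ = 1 := by
  have h := Program.normSq_setupState (d := d) (z := z) (m := m) hp
  rw [normSq_eq_norm_sq] at h
  exact (pow_eq_one_iff_of_nonneg (norm_nonneg _) two_ne_zero).1 h

lemma inner_startState (v : StateSpace d m) :
    inner ℂ (startState d z p m) v =
      ∑ x, ((√(p x) : ℝ) : ℂ) * v ((withData d x, withData d z), fun _ => false) := by
  rw [PiLp.inner_apply, Fintype.sum_prod_type, Fintype.sum_prod_type, sum_dataState]
  refine Finset.sum_congr rfl fun x _ => ?_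
  rw [Fintype.sum_eq_single (withData d z), Fintype.sum_eq_single (fun _ => false)]
  · simp only [startState, setupState, and_self, if_true, RCLike.inner_apply,
      Complex.conj_ofReal, mul_comm]
    rfl
  · intro a ha
    simp [startState, setupState, ha]
  · intro y hy
    simp [startState, setupState, hy]

lemma norm_blankProj_sq (v : StateSpace d m) :
    ‖blankProj d m v‖ ^ 2 = normSq (slice v fun _ => false) := by
  rw [EuclideanSpace.norm_sq_eq, Fintype.sum_prod_type, normSq]
  refine Finset.sum_congr rfl fun q _ => ?_
  rw [Fintype.sum_eq_single (fun _ => false)]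
  · simp [blankProj, projectLin_apply, slice]
  · intro a ha
    simp [blankProj, projectLin_apply, ha]

variable (hP : IsErgodicChain P) (hp : IsStationary P p) (hrev : IsReversibleChain P p)

include hP hp hrev

variable (W M) in
lemma approxGates_startState (N n k : ℕ) :
    actList W M (approxGates N n k) (startState d z p (N + 1)) = startState d z p (N + 1) := by
  rw [startState_eq_withBlank, approxGates, actList_append_apply,
    gadget_withBlank (isControlled_reflectRight W M _),
    walkGadgets_withBlank W M _ _ (walkMatrix_mulVec_sqrt W hP hp hrev)]
  funext q
  simp only [reflRight, Matrix.mulVec_diagonal, embedRight]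
  split_ifs <;> simp_all

variable (W M) in
-- The first interference circuit projects exactly on the blank right register. What remains is a
-- vector `u` over `X`; orthogonality to the start state says that `u` is orthogonal to `√p`, so the
-- averaging bound applies.
lemma norm_blankProj_approxGates_le {N n k : ℕ} (hk : levelOffset n (k + 1) ≤ N)
    (hgap : 0 < eigenvalueGap P) (hn : 4 ≤ 4 ^ n * eigenvalueGap P) {v : StateSpace d (N + 1)}
    (hv : v ∈ blankFrom d (N + 1) (levelOffset n k))
    (horth : inner ℂ (startState d z p (N + 1)) v = 0) :
    ‖blankProj d (N + 1) (actList W M (approxGates N n k) v)‖ ≤ precision k * ‖v‖ := by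
  rw [levelOffset] at hk
  set u : X → ℂ := fun x => v ((withData d x, withData d z), fun _ => false) with hu
  have hval : (qubit N (levelOffset n k) : ℕ) = levelOffset n k := qubit_val (by omega)
  have hc := isControlled_reflectRight (d := d) W M (qubit N (levelOffset n k))
  have hmem := gadget_apply_mem_blankFrom hc (v := v) (by rwa [hval])
  rw [hval] at hmem
  have hslice : slice (actList W M (approxGates N n k) v) (fun _ => false) =
      averageProduct (walkMatrix W) (exponents n (k + 5)) *ᵥ embedRight d z u := by
    rw [approxGates, actList_append_apply, slice_walkGadgets W M _ _
      (by rw [length_exponents]; exact hk) hmem, slice_gadget_blank hc (by rwa [hval])]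
    congr 1
    funext q
    rw [Matrix.smul_mulVec, Matrix.add_mulVec, Matrix.one_mulVec]
    simp only [Pi.smul_apply, Pi.add_apply, reflRight, Matrix.mulVec_diagonal, embedRight, hu,
      slice, withData_point, smul_eq_mul]
    obtain ⟨q₁, q₂⟩ := q
    by_cases h : q₂ = withData d z
    · subst h; simp; ring
    · simp [h]
  have hle : normSq (embedRight d z u) ≤ ‖v‖ ^ 2 := by
    rw [EuclideanSpace.norm_sq_eq, Fintype.sum_prod_type, normSq]
    refine Finset.sum_le_sum fun q _ => ?_
    refine le_trans ?_ (Finset.single_le_sum (f := fun a => ‖v (q, a)‖ ^ 2)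
      (fun a _ => sq_nonneg _) (Finset.mem_univ fun _ => false))
    obtain ⟨q₁, q₂⟩ := q
    by_cases h : q₂ = withData d z
    · simp [embedRight, h, hu, withData_point]
    · have h0 : embedRight d z u (q₁, q₂) = 0 := if_neg h
      rw [h0, norm_zero, zero_pow two_ne_zero]
      exact sq_nonneg _
  have hbound := normSq_averageProduct_le W hP hp hrev hgap hn (k + 5) (u := u)
    (by rw [← horth, inner_startState])
  refine le_of_sq_le_sq ?_ (mul_nonneg (precision_nonneg k) (norm_nonneg _))
  rw [norm_blankProj_sq, hslice, mul_pow]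
  exact hbound.trans (mul_le_mul_of_nonneg_left hle (sq_nonneg _))

variable (W M) in
/-- The approximate projection on the stationary state. -/
def approxProj (N n k : ℕ) : StateSpace d (N + 1) →ₗ[ℂ] StateSpace d (N + 1) :=
  (actList W M (approxGates N n k)).symm.toLinearEquiv.toLinearMap ∘ₗ blankProj d (N + 1) ∘ₗ
    (actList W M (approxGates N n k)).toLinearEquiv.toLinearMap

omit hP hp hrev in
variable (W M) in
lemma approxProj_apply (N n k : ℕ) (v : StateSpace d (N + 1)) :
    approxProj W M N n k v = (actList W M (approxGates N n k)).symm
      (blankProj d (N + 1) (actList W M (approxGates N n k) v)) := rfl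

variable (W M) in
lemma amplificationStep {N n k : ℕ} (hk : levelOffset n (k + 1) ≤ N)
    (hgap : 0 < eigenvalueGap P) (hn : 4 ≤ 4 ^ n * eigenvalueGap P) :
    AmplificationStep (startState d z p (N + 1)) (markedProj M d (N + 1))
      (approxProj W M N n k) (actList W M (amplifyGates N n k)) (Gate.check.act W M)
      (blankFrom d (N + 1) (levelOffset n k)) (precision k) where
  norm_start := norm_startState hp.1
  proj_marked := projectLin_isSymmetricProjection _
  proj_approx := by
    have hB : (blankProj d (N + 1)).IsSymmetricProjection := projectLin_isSymmetricProjection _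
    constructor
    · ext1 v
      rw [Module.End.mul_apply, approxProj_apply, approxProj_apply,
        LinearIsometryEquiv.apply_symm_apply, IsSymmetricProjection.apply_apply hB]
    · intro u v
      rw [approxProj_apply, approxProj_apply,
        ← (actList W M (approxGates N n k)).inner_map_map _ v,
        LinearIsometryEquiv.apply_symm_apply, hB.isSymmetric,
        ← (actList W M (approxGates N n k)).inner_map_map u,
        LinearIsometryEquiv.apply_symm_apply]
  reflect := check_act_apply W M
  fix := by
    rw [approxProj_apply, LinearIsometryEquiv.symm_apply_eq,
      approxGates_startState W M hP hp hrev]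
    refine ext_slice fun a => funext fun q => ?_
    simp only [slice, blankProj, projectLin_apply, startState, setupState]
    by_cases ha : a = fun _ => false <;> simp [ha]
  start_mem := by
    rw [startState_eq_withBlank]
    exact withBlank_mem_blankFrom _ _
  mem := by
    have hN := (levelOffset_mono n (Nat.le_succ k)).trans hk
    have hA := amplifyGates_mem_blankStabilizer W M (le_refl (levelOffset n k)) hN
    refine (inv_mem hA) _ (check_mem_blankStabilizer W M _ _ (hA _ ?_))
    rw [startState_eq_withBlank]
    exact withBlank_mem_blankFrom _ _
  nonneg := precision_nonneg k
  small v hv horth := by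
    rw [approxProj_apply, LinearIsometryEquiv.norm_map]
    exact norm_blankProj_approxGates_le W M hP hp hrev hk hgap hn hv horth

end Semantics

end

noncomputable section

/-! ## The search algorithm -/

/-- For `r` levels from level `k` on, test whether the walk has moved away from the stationary
state, and observe if this is the case. The last qubit holds the outcome of the test. -/
def searchStages (N n : ℕ) : ℕ → ℕ → Program (N + 1)
  | 0, _ => .reportEmpty
  | r + 1, k =>
    Program.gates (amplifyGates N n k ++ ([.check] ++ (invList (amplifyGates N n k) ++
        (approxGates N n k ++ [flipGate (Fin.last N)]))))
      (.measure (Fin.last N)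
        (Program.gates (invList (approxGates N n k)) (searchStages N n r (k + 1)))
        (Program.gates ([flipGate (Fin.last N)] ++ (invList (approxGates N n k) ++
          amplifyGates N n k)) (.observe .reportEmpty)))

/-- One round of the search. -/
def searchRound (N n r : ℕ) : Program (N + 1) :=
  -- The immediate observation handles a large marked mass; the second setup restores the state that
  -- it destroys.
  .setup (.observe (.setup (searchStages N n r 0)))

/-! ### Costs of the circuits and of a round. -/

section Cost

lemma Gate.cost_nonneg {m : ℕ} {U C : ℝ} (hU : 0 ≤ U) (hC : 0 ≤ C) (g : Gate m) :
    0 ≤ g.cost U C := by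
  cases g <;> simp [Gate.cost, hU, hC]

lemma listCost_nonneg {m : ℕ} {U C : ℝ} (hU : 0 ≤ U) (hC : 0 ≤ C) (L : List (Gate m)) :
    0 ≤ listCost U C L :=
  List.sum_nonneg fun a ha => by
    obtain ⟨g, -, rfl⟩ := List.mem_map.1 ha
    exact g.cost_nonneg hU hC

lemma Program.cost_nonneg {m : ℕ} {S U C : ℝ} (hS : 0 ≤ S) (hU : 0 ≤ U) (hC : 0 ≤ C)
    (A : Program m) : 0 ≤ A.cost S U C := by
  induction A with
  | reportEmpty => exact le_rfl
  | setup A ih => exact add_nonneg hS ih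
  | gate g A ih => exact add_nonneg (g.cost_nonneg hU hC) ih
  | measure i A₀ A₁ ih₀ ih₁ => exact le_max_of_le_left ih₀
  | observe A ih => exact add_nonneg hC ih

lemma listCost_gadget_walkPow {m : ℕ} (U C : ℝ) (j : Fin m) (w : ℕ) :
    listCost U C (gadget j (walkPow j w)) = w * (4 * U) := by
  have h : listCost U C (walkPow j w) = w * (4 * U) := by
    induction w with
    | zero => simp [walkPow, listCost]
    | succ w ih =>
      rw [walkPow, List.replicate_succ, List.flatten_cons, listCost_append, ← walkPow, ih]
      simp only [walkStep, listCost, List.map_cons, List.map_nil, Gate.cost, List.sum_cons,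
        List.sum_nil]
      push_cast; ring
  have h2 := listCost_append U C (walkPow j w) [hadamardGate j]
  simp only [listCost, List.map_cons, List.map_nil, List.sum_cons, List.sum_nil, gadget,
    hadamardGate, Gate.cost] at h h2 ⊢
  rw [h2, h]; ring

lemma listCost_walkGadgets (N : ℕ) (U C : ℝ) (js : List ℕ) (q : ℕ) :
    listCost U C (walkGadgets N js q) = (js.map fun j => (2 : ℝ) ^ j).sum * (4 * U) := by
  induction js generalizing q with
  | nil => simp [walkGadgets, listCost]
  | cons j js ih =>
    rw [walkGadgets, listCost_append, listCost_gadget_walkPow, ih]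
    simp only [List.map_cons, List.sum_cons]
    push_cast; ring

lemma listCost_approxGates_le (N n k : ℕ) {U C : ℝ} (hU : 0 ≤ U) :
    listCost U C (approxGates N n k) ≤ (k + 5) * (4 * U * 2 ^ n) := by
  have h1 : listCost U C (gadget (qubit N (levelOffset n k))
      [.reflectRight fun a => a (qubit N (levelOffset n k))]) = 0 := by
    simp [listCost, gadget, hadamardGate, Gate.cost]
  have h2 : ((List.range n).map fun j => (2 : ℝ) ^ j).sum = 2 ^ n - 1 := by
    induction n with
    | zero => simp
    | succ n ih =>
      have ih := ih (by simp [listCost, gadget, hadamardGate, Gate.cost])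
      rw [List.range_succ, List.map_append, List.sum_append, ih]
      simp only [List.map_cons, List.map_nil, List.sum_cons, List.sum_nil]
      ring
  have h3 : ((exponents n (k + 5)).map fun j => (2 : ℝ) ^ j).sum = (k + 5) * (2 ^ n - 1) := by
    rw [exponents, List.map_flatten, List.sum_flatten, List.map_replicate, List.map_replicate,
      List.sum_replicate, h2, nsmul_eq_mul]
    push_cast; ring
  rw [approxGates, listCost_append, h1, listCost_walkGadgets, h3]
  have : 0 ≤ ((k : ℝ) + 5) * U := by positivity
  linarith

lemma listCost_singleton_ancilla {m : ℕ} (U C : ℝ) (G : Matrix.unitaryGroup (Qubits m) ℂ) :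
    listCost U C [Gate.ancilla G] = 0 := by
  simp [listCost, Gate.cost]

/-- The terms `C/2 + (k + 11/2) w`, with `w = 4U 2^n`, absorb the inhomogeneity of `c_{k+1} ≤ 3 c_k
+ C + 2(k + 5) w`, so the left side at most triples at each step. -/
lemma listCost_amplifyGates_le (N n k : ℕ) {U C : ℝ} (hU : 0 ≤ U) :
    listCost U C (amplifyGates N n k) + C / 2 + (k + 11 / 2) * (4 * U * 2 ^ n) ≤
      3 ^ k * (C / 2 + 11 / 2 * (4 * U * 2 ^ n)) := by
  induction k with
  | zero => simp [amplifyGates, listCost]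
  | succ k ih =>
    have h1 := listCost_approxGates_le N n k (C := C) hU
    have hc : listCost U C [(Gate.check : Gate (N + 1))] = C := by simp [listCost, Gate.cost]
    have hb : listCost U C [blankGate (N + 1)] = 0 := listCost_singleton_ancilla U C _
    rw [amplifyGates]
    simp only [listCost_append, listCost_invList, hc, hb]
    rw [pow_succ]
    push_cast
    linarith

/-- Stage `k` costs at most `28 · 3^k (C + 4U 2^n)`, and `28 · 3^k = 14 (3^(k+1) - 3^k)` telescopes.
-/
lemma cost_searchStages_le (N n r k : ℕ) {S U C : ℝ} (hS : 0 ≤ S) (hU : 0 ≤ U) (hC : 0 ≤ C) :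
    (searchStages N n r k).cost S U C ≤
      14 * (C + 4 * U * 2 ^ n) * (3 ^ (k + r) - 3 ^ k) := by
  induction r generalizing k with
  | zero => simp [searchStages, Program.cost]
  | succ r ih =>
    have ih := ih (k + 1)
    have hrest := Program.cost_nonneg hS hU hC (searchStages N n r (k + 1))
    have hV := listCost_approxGates_le N n k (C := C) hU
    have hA := listCost_amplifyGates_le N n k (C := C) hU
    have hV0 := listCost_nonneg hU hC (approxGates N n k)
    have hA0 := listCost_nonneg hU hC (amplifyGates N n k)
    have hc : listCost U C [(Gate.check : Gate (N + 1))] = C := by simp [listCost, Gate.cost]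
    have hf : listCost U C [flipGate (Fin.last N)] = 0 := listCost_singleton_ancilla U C _
    have hgates : ∀ (L : List (Gate (N + 1))) A, (Program.gates L A).cost S U C =
      listCost U C L + A.cost S U C := Program.cost_gates
    simp only [searchStages, hgates, Program.cost, listCost_append, listCost_invList, hc, hf]
    set a := listCost U C (amplifyGates N n k)
    set b := listCost U C (approxGates N n k)
    set R := (searchStages N n r (k + 1)).cost S U C
    set w := 4 * U * 2 ^ n with hw
    have hw0 : 0 ≤ w := by positivity
    have hmax : max (b + R) (0 + (b + a) + (C + 0)) ≤ b + a + C + R :=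
      max_le (by linarith) (by linarith)
    have h3 : (k : ℝ) + 1 ≤ 3 ^ k := by
      have := one_add_mul_le_pow (show (-2 : ℝ) ≤ 2 by norm_num) k
      norm_num at this
      have hk : (0 : ℝ) ≤ k := Nat.cast_nonneg k
      linarith
    have h5 : ((k : ℝ) + 5) * w ≤ 5 * (3 ^ k * w) := by
      have hk : (0 : ℝ) ≤ k := Nat.cast_nonneg k
      nlinarith
    have h6 : C ≤ 3 ^ k * C := by
      have : (1 : ℝ) ≤ 3 ^ k := one_le_pow₀ (by norm_num)
      nlinarith
    have hkw : 0 ≤ ((k : ℝ) + 11 / 2) * w := by positivity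
    have e1 : (3 : ℝ) ^ (k + 1 + r) = 3 ^ (k + (r + 1)) := by ring_nf
    have e2 : (3 : ℝ) ^ (k + 1) = 3 * 3 ^ k := by ring
    rw [e1, e2] at ih
    nlinarith

lemma cost_searchRound_le (N n r : ℕ) {S U C : ℝ} (hS : 0 ≤ S) (hU : 0 ≤ U) (hC : 0 ≤ C) :
    (searchRound N n r).cost S U C ≤ 2 * S + C + 14 * (C + 4 * U * 2 ^ n) * 3 ^ r := by
  have h := cost_searchStages_le N n r 0 hS hU hC
  simp only [searchRound, Program.cost]
  rw [zero_add] at h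
  have : 0 ≤ 14 * (C + 4 * U * 2 ^ n) := by positivity
  nlinarith

end Cost

/-! ### The probability of finding a marked element. -/

section Semantics

variable {X D : Type*} [Fintype X] [DecidableEq X] {d : X → D} {z : X}
  {P : Matrix X X ℝ} {p : X → ℝ} {m : ℕ} (W : WalkUpdates d z P p) (M : Finset X)

namespace Program

lemma findProb_gates (L : List (Gate m)) (k : Program m) (v : StateSpace d m) :
    (gates L k).findProb W M v.ofLp = k.findProb W M (actList W M L v).ofLp :=
  Finset.sum_congr rfl fun _ _ => run_gates_eq W M L k v _

lemma findProb_setup (k : Program m) (v : Basis d m → ℂ) :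
    (setup k).findProb W M v = normSq v * k.findProb W M (startState d z p m).ofLp := by
  simp only [findProb, run, ← Finset.mul_sum]
  rfl

lemma findProb_measure (i : Fin m) (k₀ k₁ : Program m) (v : StateSpace d m) :
    (measure i k₀ k₁).findProb W M v.ofLp =
      k₀.findProb W M (projectLin (fun b : Basis d m => !b.2 i) v).ofLp +
        k₁.findProb W M (projectLin (fun b : Basis d m => b.2 i) v).ofLp := by
  simp only [findProb, run, Finset.sum_add_distrib]
  rfl

lemma norm_markedProj_sq (v : StateSpace d m) :
    ‖markedProj M d m v‖ ^ 2 =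
      ∑ x ∈ M, normSq (project (fun b : Basis d m => decide (b.1.1.point = x)) v.ofLp) := by
  rw [EuclideanSpace.norm_sq_eq]
  simp only [normSq, project]
  rw [Finset.sum_comm]
  refine Finset.sum_congr rfl fun b _ => ?_
  rw [markedProj, projectLin_apply]
  by_cases hb : b.1.1.point ∈ M
  · rw [Finset.sum_eq_single b.1.1.point]
    · simp [hb]
    · intro x _ hx; simp [hx.symm]
    · exact fun h => (h hb).elim
  · rw [Finset.sum_eq_zero]
    · simp [hb]
    · intro x hx
      have : b.1.1.point ≠ x := fun h => hb (h ▸ hx)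
      simp [this]

lemma findProb_observe (k : Program m) (v : StateSpace d m) :
    (observe k).findProb W M v.ofLp = ‖markedProj M d m v‖ ^ 2 +
      ∑ x ∈ Mᶜ, k.findProb W M (project (fun b => decide (b.1.1.point = x)) v.ofLp) := by
  simp only [findProb, run]
  rw [Finset.sum_comm, ← Finset.sum_add_sum_compl M, norm_markedProj_sq]
  congr 1
  · refine Finset.sum_congr rfl fun x hx => ?_
    rw [Finset.sum_eq_single x]
    · simp [hx]
    · intro y _ hy; simp [hx, hy]
    · exact fun h => (h hx).elim
  · refine Finset.sum_congr rfl fun x hx => Finset.sum_congr rfl fun y _ => ?_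
    rw [if_neg (Finset.mem_compl.1 hx)]

lemma norm_sq_le_findProb_observe (k : Program m) (v : StateSpace d m) :
    ‖markedProj M d m v‖ ^ 2 ≤ (observe k).findProb W M v.ofLp := by
  rw [findProb_observe]
  have : 0 ≤ ∑ x ∈ Mᶜ, k.findProb W M (project (fun b => decide (b.1.1.point = x)) v.ofLp) :=
    Finset.sum_nonneg fun _ _ => findProb_nonneg W M k _
  linarith

end Program

/-- The test whether the walk has returned to the stationary state succeeds exactly on the
states with blank ancilla qubits. -/
lemma flipGate_projectLin_flipGate {N : ℕ} {v : StateSpace d (N + 1)}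
    (hv : v ∈ blankFrom d (N + 1) N) :
    (flipGate (Fin.last N)).act W M (projectLin (fun b => b.2 (Fin.last N))
      ((flipGate (Fin.last N)).act W M v)) = v - blankProj d (N + 1) v := by
  have hslice : ∀ (u : StateSpace d (N + 1)) (a : Qubits (N + 1)),
      slice (projectLin (fun b => b.2 (Fin.last N)) u) a =
        if a (Fin.last N) = true then slice u a else 0 := fun u a => by
    funext q
    simp only [slice, projectLin_apply]
    split_ifs <;> rfl
  refine ext_slice fun a => ?_
  rw [slice_flipGate, hslice, slice_flipGate, flipUnlessBlank_flipUnlessBlank]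
  have hr : slice (v - blankProj d (N + 1) v) a =
      if a = fun _ => false then 0 else slice v a := by
    funext q
    simp only [slice, PiLp.sub_apply, blankProj, projectLin_apply, decide_eq_true_eq]
    split_ifs
    · rw [sub_self]; rfl
    · rw [sub_zero]; rfl
  rw [hr]
  by_cases hlast : a (Fin.last N) = true
  · rw [hv a ⟨Fin.last N, by simp, hlast⟩, ite_self, ite_self]
  · rw [Bool.not_eq_true] at hlast
    have hiff : flipUnlessBlank (Fin.last N) a (Fin.last N) = true ↔ ¬ a = fun _ => false := by
      rw [flipUnlessBlank]
      split_ifs with h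
      · have ha : a = fun _ => false := by
          funext i
          by_cases hi : i = Fin.last N
          · rw [hi, hlast]
          · exact h i hi
        simp [ha]
      · rw [Function.update_self, hlast]
        simp only [Bool.not_false, true_iff]
        rintro rfl
        exact h fun _ _ => rfl
    by_cases ha : a = fun _ => false
    · rw [if_pos ha, if_neg (by rw [hiff]; exact not_not.2 ha)]
    · rw [if_neg ha, if_pos (hiff.2 ha)]

/-- The amplitude of the marked states at a level of the recursion. -/
def levelAmplitude (N n k : ℕ) : ℝ :=
  ‖markedProj M d (N + 1) (actList W M (amplifyGates N n k) (startState d z p (N + 1)))‖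

variable (hP : IsErgodicChain P) (hp : IsStationary P p) (hrev : IsReversibleChain P p)

include hP hp hrev

lemma levelAmplitude_succ {N n k : ℕ} (hk : levelOffset n (k + 1) ≤ N)
    (hgap : 0 < eigenvalueGap P) (hn : 4 ≤ 4 ^ n * eigenvalueGap P) :
    (3 - 4 * levelAmplitude W M N n k ^ 2 - 4 * precision k) * levelAmplitude W M N n k ≤
        levelAmplitude W M N n (k + 1) ∧
      levelAmplitude W M N n (k + 1) ≤ (3 + 4 * precision k) * levelAmplitude W M N n k := by
  set V := actList W M (approxGates N n k)
  have hR : ∀ v, (V⁻¹ * (blankGate (N + 1)).act W M * V) v =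
      (2 : ℂ) • approxProj W M N n k v - v := fun v => by
    change V.symm ((blankGate (N + 1)).act W M (V v)) = _
    rw [blankGate_act_apply, map_sub, map_smul, V.symm_apply_apply, approxProj_apply]
  have h := (amplificationStep W M hP hp hrev hk hgap hn).norm_amplify _ hR
  have heq : levelAmplitude W M N n (k + 1) = ‖markedProj M d (N + 1)
      (actList W M (amplifyGates N n k) ((V⁻¹ * (blankGate (N + 1)).act W M * V)
        ((actList W M (amplifyGates N n k)).symm (Gate.check.act W M
          (actList W M (amplifyGates N n k) (startState d z p (N + 1)))))))‖ := by
    have hmul : ∀ v, (V⁻¹ * (blankGate (N + 1)).act W M * V) v =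
      V.symm ((blankGate (N + 1)).act W M (V v)) := fun _ => rfl
    rw [levelAmplitude, amplifyGates, hmul]
    simp only [actList_append_apply, actList_invList_apply, actList_cons, actList_nil, V]
  rw [heq]
  unfold levelAmplitude
  convert h using 3

/-- If the state at the beginning of the stages is close to the stationary state, and the
amplitudes of the skipped levels are small, then a marked element is found at level `i`. -/
lemma sq_le_findProb_searchStages {N n r k i : ℕ} (hN : levelOffset n (k + r) ≤ N)
    (hgap : 0 < eigenvalueGap P) (hn : 4 ≤ 4 ^ n * eigenvalueGap P) (hki : k ≤ i)
    (hik : i < k + r) (v : StateSpace d (N + 1)) {c : ℝ} (hc0 : 0 ≤ c)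
    (hc : c ≤ 2 * levelAmplitude W M N n i *
        (1 - levelAmplitude W M N n i ^ 2 - precision i) -
      ‖v - startState d z p (N + 1)‖ - 2 * ∑ j ∈ Finset.Ico k i, levelAmplitude W M N n j) :
    c ^ 2 ≤ (searchStages N n r k).findProb W M v.ofLp := by
  induction r generalizing k v with
  | zero => omega
  | succ r ih =>
    have hk1 : levelOffset n (k + 1) ≤ N := (levelOffset_mono n (by omega)).trans hN
    have hstep := amplificationStep (d := d) (z := z) W M hP hp hrev hk1 hgap hn
    have hfix := approxGates_startState (d := d) (z := z) W M hP hp hrev N n k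
    set s := startState d z p (N + 1) with hs
    set A := actList W M (amplifyGates N n k) with hA
    set V := actList W M (approxGates N n k) with hV
    set B : StateSpace d (N + 1) ≃ₗᵢ[ℂ] StateSpace d (N + 1) := Gate.check.act W M with hB
    set F : StateSpace d (N + 1) ≃ₗᵢ[ℂ] StateSpace d (N + 1) :=
      (flipGate (Fin.last N)).act W M with hF
    set P₀ : StateSpace d (N + 1) →ₗ[ℂ] StateSpace d (N + 1) :=
      projectLin fun b => !b.2 (Fin.last N) with hP₀
    set P₁ : StateSpace d (N + 1) →ₗ[ℂ] StateSpace d (N + 1) :=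
      projectLin fun b => b.2 (Fin.last N) with hP₁
    have hrun : (searchStages N n (r + 1) k).findProb W M v.ofLp =
        (searchStages N n r (k + 1)).findProb W M
          (V.symm (P₀ (F (V (A.symm (B (A v))))))).ofLp +
        (Program.observe .reportEmpty).findProb W M
          (A (V.symm (F (P₁ (F (V (A.symm (B (A v)))))))) ).ofLp := by
      rw [searchStages, Program.findProb_gates, Program.findProb_measure,
        Program.findProb_gates, Program.findProb_gates]
      simp only [actList_append_apply, actList_invList_apply, actList_cons, actList_nil, hA, hV,
        hB, hF, hP₀, hP₁]
    have hsF : F s = s := by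
      refine ext_slice fun a => ?_
      rw [hF, slice_flipGate, hs, startState_eq_withBlank, slice_withBlank, slice_withBlank]
      have : flipUnlessBlank (Fin.last N) a = (fun _ => false) ↔ a = fun _ => false := by
        have h0 : flipUnlessBlank (Fin.last N) (fun _ => false) = fun _ => false :=
          if_pos fun _ _ => rfl
        constructor
        · intro h
          rw [← flipUnlessBlank_flipUnlessBlank (Fin.last N) a, h, h0]
        · rintro rfl; exact h0
      simp only [this]
    rw [hrun]
    rcases hki.eq_or_lt with rfl | hlt
    -- At the good level only the branch of the failed test counts. It is evaluated on the exact
    -- state `s`; all maps involved are contractions, so starting from `v` loses at most `‖v - s‖`.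
    · refine le_trans ?_ (le_add_of_nonneg_left (Program.findProb_nonneg W M _ _))
      refine le_trans ?_ (Program.norm_sq_le_findProb_observe W M _ _)
      refine pow_le_pow_left₀ hc0 ?_ 2
      set w := A.symm (B (A s)) with hw
      have hwF : V w ∈ blankFrom d (N + 1) N :=
        approxGates_mem_blankStabilizer W M hk1 le_rfl _
          (blankFrom_mono ((levelOffset_mono n (Nat.le_succ k)).trans hk1) hstep.mem)
      have hmain := hstep.norm_failed_test
      rw [← hw] at hmain
      have hAs : A (V.symm (F (P₁ (F (V w))))) = A (w - approxProj W M N n k w) := by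
        rw [hF, hP₁, flipGate_projectLin_flipGate W M hwF, map_sub, V.symm_apply_apply,
          approxProj_apply]
      have hdiff : ‖markedProj M d (N + 1) (A (V.symm (F (P₁ (F (V w)))))) -
          markedProj M d (N + 1) (A (V.symm (F (P₁ (F (V (A.symm (B (A v)))))))))‖ ≤
          ‖v - s‖ := by
        rw [hw, ← map_sub, ← map_sub, ← map_sub, ← map_sub, ← map_sub, ← map_sub, ← map_sub,
          ← map_sub, ← map_sub, ← map_sub]
        refine (IsSymmetricProjection.norm_apply_le (projectLin_isSymmetricProjection _) _).trans ?_
        rw [A.norm_map, V.symm.norm_map, F.norm_map]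
        refine (IsSymmetricProjection.norm_apply_le (projectLin_isSymmetricProjection _) _).trans ?_
        rw [F.norm_map, V.norm_map, A.symm.norm_map, B.norm_map, A.norm_map, norm_sub_rev]
      rw [hAs] at hdiff
      have htri := norm_sub_norm_le (markedProj M d (N + 1) (A (w - approxProj W M N n k w)))
        (markedProj M d (N + 1) (A (V.symm (F (P₁ (F (V (A.symm (B (A v))))))))))
      rw [Finset.Ico_self, Finset.sum_empty, mul_zero, sub_zero] at hc
      change c ≤ 2 * ‖markedProj M d (N + 1) (A s)‖ *
        (1 - ‖markedProj M d (N + 1) (A s)‖ ^ 2 - precision k) - ‖v - s‖ at hc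
      linarith
    -- At a skipped level only the branch of the successful test is followed. The test fixes `s` and
    -- contracts, so the distance to `s` grows by at most `‖A⁻¹BAs - s‖`, twice the marked
    -- amplitude.
    · refine le_trans ?_ (le_add_of_nonneg_right (Program.findProb_nonneg W M _ _))
      refine ih (by rwa [← Nat.succ_add_eq_add_succ] at hN) hlt (by omega) _ ?_
      have hsP : P₀ s = s := by
        refine ext_slice fun a => funext fun q => ?_
        simp only [hP₀, slice, projectLin_apply, hs, startState, setupState]
        by_cases ha : a = fun _ => false <;> simp [ha]
      have hs' : s = V.symm (P₀ (F (V s))) := by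
        rw [hfix, hsF, hsP, LinearIsometryEquiv.eq_symm_apply, hfix]
      have h1 : ‖V.symm (P₀ (F (V (A.symm (B (A v)))))) - s‖ ≤ ‖A.symm (B (A v)) - s‖ := by
        conv_lhs => rw [hs']
        rw [← map_sub, ← map_sub, ← map_sub, ← map_sub, V.symm.norm_map]
        refine (IsSymmetricProjection.norm_apply_le (projectLin_isSymmetricProjection _) _).trans ?_
        rw [F.norm_map, V.norm_map]
      have h2 : ‖A.symm (B (A v)) - s‖ ≤ ‖v - s‖ + 2 * levelAmplitude W M N n k := by
        have e1 : ‖A.symm (B (A v)) - A.symm (B (A s))‖ = ‖v - s‖ := by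
          rw [← map_sub, ← map_sub, ← map_sub, A.symm.norm_map, B.norm_map, A.norm_map]
        have e2 : ‖A.symm (B (A s)) - s‖ = 2 * levelAmplitude W M N n k := by
          have : A.symm (B (A s)) - s = A.symm (-((2 : ℂ) • markedProj M d (N + 1) (A s))) := by
            rw [hstep.reflect, map_sub, A.symm_apply_apply, map_neg]
            abel
          rw [this, A.symm.norm_map, norm_neg, norm_smul, Complex.norm_ofNat]
          rfl
        calc _ ≤ ‖A.symm (B (A v)) - A.symm (B (A s))‖ + ‖A.symm (B (A s)) - s‖ :=
              norm_sub_le_norm_sub_add_norm_sub _ _ _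
          _ = _ := by rw [e1, e2]
      rw [Finset.sum_eq_sum_Ico_succ_bot hlt] at hc
      linarith

omit hP hrev in
lemma levelAmplitude_zero_sq (N n : ℕ) :
    levelAmplitude (d := d) (z := z) W M N n 0 ^ 2 = ∑ x ∈ M, p x := by
  rw [levelAmplitude, amplifyGates, actList_nil, EuclideanSpace.norm_sq_eq,
    Fintype.sum_prod_type, Fintype.sum_prod_type, sum_dataState]
  have key : ∀ x, (∑ y, ∑ a, ‖markedProj M d (N + 1) (startState d z p (N + 1))
      ((withData d x, y), a)‖ ^ 2) = if x ∈ M then p x else 0 := fun x => by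
    have hx : (withData d x).point = x := rfl
    rw [Fintype.sum_eq_single (withData d z), Fintype.sum_eq_single (fun _ => false)]
    · simp only [markedProj, projectLin_apply, startState, setupState, and_self, if_true, hx,
        decide_eq_true_eq]
      split_ifs
      · rw [Complex.norm_real, Real.norm_eq_abs, sq_abs, Real.sq_sqrt (hp.1.1 x)]
      · simp
    · intro a ha
      simp [markedProj, projectLin_apply, startState, setupState, ha]
    · intro y hy
      simp [markedProj, projectLin_apply, startState, setupState, hy]
  simp only [key]
  rw [Finset.sum_ite_mem, Finset.univ_inter]

/-- A round of the search finds a marked element with constant probability. -/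
lemma le_findProb_searchRound {N n T : ℕ} (hN : levelOffset n (T + 1) ≤ N)
    (hgap : 0 < eigenvalueGap P) (hn : 4 ≤ 4 ^ n * eigenvalueGap P) {ε : ℝ}
    (hT : 1 ≤ 3 ^ T * √ε) (hM : ε ≤ ∑ x ∈ M, p x) :
    1 / 2000 ≤ (searchRound N n (T + 1)).findProb W M (blankState d z (N + 1)) := by
  set s := startState d z p (N + 1) with hs
  set f := (searchStages N n (T + 1) 0).findProb W M s.ofLp with hf
  set x : ℕ → ℝ := levelAmplitude (d := d) (z := z) W M N n with hx
  have hx0 : ‖markedProj M d (N + 1) s‖ ^ 2 = x 0 ^ 2 := rfl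
  have hsn : normSq s.ofLp = 1 := Program.normSq_setupState hp.1
  have hround : (searchRound N n (T + 1)).findProb W M (blankState d z (N + 1)) =
      x 0 ^ 2 + (1 - x 0 ^ 2) * f := by
    have h1 := Finset.sum_add_sum_compl M fun y =>
      normSq (project (fun b : Basis d (N + 1) => decide (b.1.1.point = y)) s.ofLp)
    rw [← Program.norm_markedProj_sq, hx0,
      sum_normSq_project (fun b : Basis d (N + 1) => b.1.1.point), hsn] at h1
    rw [searchRound, Program.findProb_setup, Program.normSq_blankState, one_mul,
      Program.findProb_observe, hx0]
    simp only [Program.findProb_setup]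
    rw [← Finset.sum_mul, eq_sub_of_add_eq' h1]
  have hf0 : 0 ≤ f := Program.findProb_nonneg W M _ _
  have hxn : ∀ k, 0 ≤ x k := fun k => norm_nonneg _
  have hx1 : x 0 ≤ 1 := by
    refine (IsSymmetricProjection.norm_apply_le (projectLin_isSymmetricProjection _) _).trans ?_
    rw [LinearIsometryEquiv.norm_map, norm_startState hp.1]
  rw [hround]
  -- An amplitude of at least `1/10` is found by the first observation with probability `1/100`;
  -- otherwise the good level comes from the growth analysis.
  by_cases hbig : 1 / 10 ≤ x 0
  · nlinarith [mul_nonneg (show 0 ≤ 1 - x 0 ^ 2 by nlinarith [hxn 0]) hf0]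
  have hsmall : x 0 ^ 2 ≤ 1 / 100 := by nlinarith [hxn 0]
  suffices hmain : (3 / 100) ^ 2 ≤ f by nlinarith [sq_nonneg (x 0)]
  have hε : √ε ≤ x 0 := by
    refine (Real.sqrt_le_sqrt hM).trans ?_
    rw [← levelAmplitude_zero_sq W M hp N n, Real.sqrt_sq (hxn 0)]
  obtain ⟨k, hk, hk1, hk2, hk3⟩ : ∃ k ≤ T, 1 / 10 ≤ x k ∧ x k ≤ 1 / 3 ∧
      ∑ j ∈ Finset.range k, x j ≤ 2 / 3 * x k := by
    have hsucc : ∀ k < T, _ := fun k hk => levelAmplitude_succ (z := z) W M hP hp hrev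
      ((levelOffset_mono n (by omega : k + 1 ≤ T + 1)).trans hN) hgap hn
    refine (exists_good_level (n := T) hxn (fun k hk => (hsucc k hk).1)
      (fun k hk => (hsucc k hk).2) (hT.trans ?_)).resolve_left hbig
    exact mul_le_mul_of_nonneg_left hε (by positivity)
  refine sq_le_findProb_searchStages W M hP hp hrev (i := k) (by rwa [zero_add]) hgap hn
    (Nat.zero_le _) (by omega) s (by norm_num) ?_
  rw [← Finset.range_eq_Ico, sub_self, norm_zero]
  change _ ≤ 2 * x k * (1 - x k ^ 2 - precision k) - 0 - 2 * ∑ j ∈ Finset.range k, x j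
  -- `1 - 1/9 - 1/32 ≥ 6/7`, so the surviving amplitude is at least `(12/7 - 4/3) x_k = (8/21) x_k`,
  -- which exceeds `3/100` as `x_k ≥ 1/10`.
  have h5 : 1 - x k ^ 2 - precision k ≥ 6 / 7 := by nlinarith [precision_le k]
  nlinarith [mul_le_mul_of_nonneg_left h5 (hxn k)]

end Semantics

end

/-! ### Choice of the parameters and conclusion. -/

lemma exists_pow_mul_near {b e : ℝ} (hb : 1 < b) (he : 0 < e) (he1 : e ≤ 1) :
    ∃ n : ℕ, 1 ≤ b ^ n * e ∧ b ^ n * e ≤ b := by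
  obtain ⟨n, h1, h2⟩ := exists_nat_pow_near ((one_le_inv₀ he).2 he1) hb
  refine ⟨n + 1, ?_, ?_⟩
  · have := mul_le_mul_of_nonneg_right h2.le he.le
    rwa [inv_mul_cancel₀ he.ne'] at this
  · have := mul_le_mul_of_nonneg_right h1 he.le
    rw [inv_mul_cancel₀ he.ne'] at this
    rw [pow_succ]
    nlinarith

lemma Program.successProb_of_nonempty {X D : Type*} [Fintype X] [DecidableEq X] {d : X → D}
    {z : X} {P : Matrix X X ℝ} {p : X → ℝ} {m : ℕ} (W : WalkUpdates d z P p) {M : Finset X}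
    (hM : M.Nonempty) (A : Program m) :
    A.successProb W M = A.findProb W M (blankState d z m) := by
  rw [successProb, if_neg hM.ne_empty]; rfl

/-- The cost of a round, for matching numbers of levels and walk steps. -/
lemma cost_searchRound_le_of_near {N n T : ℕ} {δ ε : ℝ} (hδ : 0 < δ) (hε : 0 < ε) (hε1 : ε ≤ 1)
    (hT : 3 ^ T * √ε ≤ 3) (hn : 2 ^ n * (√δ / 2) ≤ 2) {S U C : ℝ} (hS : 0 ≤ S) (hU : 0 ≤ U)
    (hC : 0 ≤ C) :
    (searchRound N n (T + 1)).cost S U C ≤ 2100 * (S + 1 / √ε * (1 / √δ * U + C)) := by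
  refine (cost_searchRound_le N n (T + 1) hS hU hC).trans ?_
  have hsδ := Real.sqrt_pos.2 hδ
  have hsε := Real.sqrt_pos.2 hε
  have h1 : (3 : ℝ) ^ T ≤ 3 * (1 / √ε) := by
    rw [mul_one_div, le_div_iff₀ hsε]; exact hT
  have h2 : (2 : ℝ) ^ n ≤ 4 * (1 / √δ) := by
    rw [mul_one_div, le_div_iff₀ hsδ]; linarith
  have h3 : 1 ≤ 1 / √ε := by
    rw [le_div_iff₀ hsε, one_mul]
    exact Real.sqrt_le_one.2 hε1
  have h4 : C + 4 * U * 2 ^ n ≤ 16 * (1 / √δ * U + C) := by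
    have := mul_le_mul_of_nonneg_left h2 (show 0 ≤ 4 * U by positivity)
    linarith
  have hw : 0 ≤ 1 / √δ * U + C := by positivity
  have h5 : C ≤ 1 / √ε * (1 / √δ * U + C) := by
    have : 0 ≤ 1 / √δ * U := by positivity
    nlinarith
  -- The dominant constant is `14 · 16 · 9 = 2016`; the first observation and the two setups fit
  -- into `2100`.
  have h6 : 14 * (C + 4 * U * 2 ^ n) * 3 ^ (T + 1) ≤
      14 * (16 * (1 / √δ * U + C)) * (3 * (3 * (1 / √ε))) := by
    rw [pow_succ, mul_comm ((3 : ℝ) ^ T)]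
    gcongr
  nlinarith

end QuantumWalkSearch

theorem mainTheorem1 :
    ∀ η : ℝ, 0 < η → ∃ K : ℝ, ∀ δ ε : ℝ, 0 < δ → 0 < ε →
      ∃ (m : ℕ) (A : Program m),
        (∀ S U C : ℝ, 0 ≤ S → 0 ≤ U → 0 ≤ C →
          A.cost S U C ≤ K * (S + 1 / √ε * (1 / √δ * U + C))) ∧
        ∀ (X : Type*) (D : Type*) [Fintype X] [DecidableEq X]
          (P : Matrix X X ℝ) (p : X → ℝ) (d : X → D) (z : X) (W : WalkUpdates d z P p)
          (M : Finset X),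
          IsErgodicChain P → IsStationary P p → IsReversibleChain P p →
          eigenvalueGap P = δ → (M.Nonempty → ε ≤ ∑ x ∈ M, p x) →
          1 - η ≤ A.successProb W M := by
  intro η hη
  obtain ⟨L, hL⟩ := exists_pow_lt_of_lt_one hη (show (1 - 1 / 2000 : ℝ) < 1 by norm_num)
  refine ⟨L * 2100, fun δ ε hδ hε => ?_⟩
  -- A gap and a probability mass never exceed `1`. For other parameters only the case of empty `M`
  -- can arise, and reporting emptiness at no cost is right.
  by_cases hsmall : δ ≤ 1 ∧ ε ≤ 1
  · obtain ⟨hδ1, hε1⟩ := hsmall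
    obtain ⟨T, hT1, hT2⟩ := exists_pow_mul_near (b := 3) (by norm_num) (Real.sqrt_pos.2 hε)
      (Real.sqrt_le_one.2 hε1)
    have hsδ := Real.sqrt_pos.2 hδ
    have hsδ1 : √δ ≤ 1 := Real.sqrt_le_one.2 hδ1
    -- `2^n √δ / 2 ≥ 1` is the condition `4 ≤ 4^n δ` under which one block of averages halves the
    -- error; the upper bound keeps `2^n` of order `1/√δ`.
    obtain ⟨n, hn1, hn2⟩ := exists_pow_mul_near (b := 2) (e := √δ / 2) (by norm_num)
      (by positivity) (by linarith)
    refine ⟨levelOffset n (T + 1) + 1, (searchRound (levelOffset n (T + 1)) n (T + 1)).iterate L,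
      fun S U C hS hU hC => ?_, ?_⟩
    · rw [Program.cost_iterate, mul_assoc]
      exact mul_le_mul_of_nonneg_left
        (cost_searchRound_le_of_near hδ hε hε1 hT2 hn2 hS hU hC) (Nat.cast_nonneg L)
    · intro X D _ _ P p d z W M hP hp hrev hgap hM
      rcases M.eq_empty_or_nonempty with rfl | hne
      · rw [Program.successProb_of_empty W hp.1]
        linarith
      · have hn : 4 ≤ 4 ^ n * eigenvalueGap P := by
          have h4 : (4 : ℝ) ^ n = 2 ^ n * 2 ^ n := by rw [← mul_pow]; norm_num
          have h2 : 2 ≤ 2 ^ n * √δ := by linarith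
          rw [hgap, h4, ← Real.mul_self_sqrt hδ.le]
          nlinarith
        have hround := le_findProb_searchRound W M hP hp hrev le_rfl (hgap ▸ hδ) hn hT1 (hM hne)
        have h := (Program.one_sub_pow_le_findProb_iterate W M hp.1 _ hround (by norm_num) L).2
        rw [Program.successProb_of_nonempty W hne]
        exact le_trans (by linarith) h
  · refine ⟨0, .reportEmpty, fun S U C hS hU hC => ?_, ?_⟩
    · simp only [Program.cost]
      positivity
    · intro X D _ _ P p d z W M hP hp hrev hgap hM
      rcases M.eq_empty_or_nonempty with rfl | hne
      · rw [Program.successProb_of_empty W hp.1]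
        linarith
      · refine absurd ⟨hgap ▸ eigenvalueGap_le_one P, (hM hne).trans ?_⟩ hsmall
        rw [← hp.1.2]
        exact Finset.sum_le_sum_of_subset_of_nonneg (Finset.subset_univ M) fun x _ _ => hp.1.1 x
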